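/- Throughout, for $z\in\mathbb C\setminus[0,\infty)$ let $\sqrt z$ be the square root with $\operatorname{Im}\sqrt z>0$, let $W_x(u,v)=u(x)v'(x)-u'(x)v(x)$, let $u^*$ denote the conjugate transpose, and let $J=\begin{bmatrix}0&1\\-1&0\end{bmatrix}$. Let $\mu\in\mathbb C$ with $\mu\neq\bar\mu$, let $d\in\mathbb R$, and put $A=\begin{bmatrix}\mu&1\\0&\mu\end{bmatrix}$, $\omega=\mathrm i\sqrt\mu$, $\mathcal A=-\mathrm i\omega I_2+\frac{\mathrm i}{2\omega}\begin{bmatrix}0&1\\0&0\end{bmatrix}$, $c_1=1+\frac d\omega$, $c_2=1-\frac d\omega$, $c_3=\frac{c_1}{2\omega}$, $c_4=\frac{d}{2\omega^3}$, $c_5=-\frac{c_2}{2\omega}$, $$\Lambda_1(x)=\frac{\mathrm i}{2}\mathcal A\left(e^{-\omega x}\begin{bmatrix}c_3x+c_4\\c_1\end{bmatrix}-e^{\omega x}\begin{bmatrix}c_5x-c_4\\c_2\end{bmatrix}\right),\qquad \Lambda_2(x)=\frac12\left(e^{-\omega x}\begin{bmatrix}c_3x+c_4\\c_1\end{bmatrix}+e^{\omega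 x}\begin{bmatrix}c_5x-c_4\\c_2\end{bmatrix}\right),$$ $\Lambda=[\Lambda_1\ \Lambda_2]$ and $S(x)=\int_0^x\Lambda_2(t)\Lambda_2(t)^*\,dt$. For $x>0$ put $$\tilde q=2\Big((\Lambda_2^*S^{-1}\Lambda_2)^2+\Lambda_1^*S^{-1}\Lambda_2+\Lambda_2^*S^{-1}\Lambda_1\Big),\qquad w_A(z,x)=I_2+J\Lambda(x)^*S(x)^{-1}(zI_2-A)^{-1}\Lambda(x)\quad(z\ne\mu),$$ $$\tilde y(z,x)=\begin{bmatrix}1&0\end{bmatrix}w_A(z,x)w(z,x),\qquad w(z,x)=T(z)\begin{bmatrix}e^{\mathrm i\sqrt zx}&0\\0&e^{-\mathrm i\sqrt zx}\end{bmatrix}T(z)^{-1},\qquad T(z)=\begin{bmatrix}1&1\\ \mathrm i\sqrt z&-\mathrm i\sqrt z\end{bmatrix},$$ where $w$ does not depend on the choice of the square root and $w(0,x)=\begin{bmatrix}1&x\\0&1\end{bmatrix}$ is defined by continuity. Then the following hold. 1. $\Lambda_1'=A\Lambda_2$ and $\Lambda_2'=-\Lambda_1$ on $\mathbb R$, with $\Lambda_1(0)=\begin{bmatrix}0\\d\end{bmatrix}$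 and $\Lambda_2(0)=\begin{bmatrix}0\\1\end{bmatrix}$. 2. $S(x)>0$ for all $x>0$. The potential $\tilde q$ is real-valued and continuous on $(0,\infty)$, and $\tilde q(x)=\frac{12}{x^2}\big(1+O(x)\big)$ as $x\downarrow0$ (that is, the leading term is $l(l+1)x^{-2}$ with $l=3$). 3. There are functions $\tilde\phi(z,x)$, $\tilde\theta(z,x)$ ($z\in\mathbb C$, $x>0$), entire in $z$ and real for $z\in\mathbb R$, such that $$\tilde\phi(z,x)=\frac{\tilde y(z,x)}{(z-\bar\mu)^2}\begin{bmatrix}1\\-d\end{bmatrix}\ (z\neq\mu,\bar\mu),\qquad \tilde\theta(z,x)=-(z-\mu)^2\,\tilde y(z,x)\begin{bmatrix}0\\1\end{bmatrix}\ (z\ne\mu).$$ For every $z\in\mathbb C$ both solve $-u''+\tilde q u=zu$ on $(0,\infty)$ and $W_x(\tilde\theta(z),\tilde\phi(z))=1$. Moreover $\tilde\phi(z,\cdot)$ is nonsingular at $x=0$: it has a finite limit as $x\downarrow0$, and it belongs to $L^2(0,c)$ for every $c>0$. 4. The singular Weyl function of this system of solutions is $$\tilde M(z)=-(z-\mu)^2(z-\bar\mu)^2\big(\mathrm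 i\sqrt z+d\big)^{-1}.$$ That is, for every $z\in\mathbb C\setminus[0,\infty)$ with $\mathrm i\sqrt z+d\neq0$ the equation $-u''+\tilde qu=zu$ has a nontrivial solution that is in $L^2(c,\infty)$ for every $c>0$, and for every such solution $u$ and every $x>0$ one has $W_x(\tilde\phi(z),u)\ne0$ and $\tilde M(z)=-\dfrac{W_x(\tilde\theta(z),u)}{W_x(\tilde\phi(z),u)}$. One has $\mathrm i\sqrt z+d\neq0$ for all $z\in\mathbb C\setminus\mathbb R$, $\tilde M$ is analytic in $\mathbb C\setminus\mathbb R$, and the zeros of $\tilde M$ in $\{z\in\mathbb C\setminus[0,\infty):\mathrm i\sqrt z+d\ne0\}$ are exactly the non-real points $\mu$ and $\bar\mu$. -/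

import Mathlib

open scoped Matrix Topology ComplexConjugate ComplexOrder
open MeasureTheory Set Filter

noncomputable section

namespace GBDT

/-! ### One-dimensional Schrödinger equations on the half-line -/

/-- `u` solves `-u'' + q u = z u` on `(0, ∞)`.  Solutions are taken in the classical sense, which is
the same as the absolutely continuous sense for potentials that are continuous on `(0, ∞)`. -/
def IsSolution (q : ℝ → ℂ) (z : ℂ) (u : ℝ → ℂ) : Prop :=
  ∀ x : ℝ, 0 < x → DifferentiableAt ℝ u x ∧ DifferentiableAt ℝ (deriv u) x ∧
    -deriv (deriv u) x + q x * u x = z * u x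

/-- The Wronskian `W_x(u, v) = u(x) v'(x) - u'(x) v(x)`. -/
def wronskian (u v : ℝ → ℂ) (x : ℝ) : ℂ := u x * deriv v x - deriv u x * v x

/-- `u` is a Weyl solution at `∞`: a nontrivial solution of `-u'' + q u = z u` on `(0, ∞)` that is
square integrable near `∞`. -/
def IsWeylSolution (q : ℝ → ℂ) (z : ℂ) (u : ℝ → ℂ) : Prop :=
  IsSolution q z u ∧ (∃ x : ℝ, 0 < x ∧ u x ≠ 0) ∧
    ∀ c : ℝ, 0 < c → MemLp u 2 (volume.restrict (Ioi c))

/-- `m` is the value at `z` of the singular Weyl function of `-d²/dx² + q` with respect to the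
system of solutions `φ`, `θ`: a Weyl solution `u` at `∞` exists, and for every one of them
`m = - W(θ(z), u) / W(φ(z), u)`, where the denominator does not vanish. -/
def IsSingularWeylValue (q : ℝ → ℂ) (φ θ : ℂ → ℝ → ℂ) (z m : ℂ) : Prop :=
  (∃ u, IsWeylSolution q z u) ∧
    ∀ u, IsWeylSolution q z u → ∀ x : ℝ, 0 < x →
      wronskian (φ z) u x ≠ 0 ∧ m = -wronskian (θ z) u x / wronskian (φ z) u x

/-! ### The square root -/

/-- The square root with positive imaginary part on `ℂ \ [0, ∞)`. -/
def sqrtUp (z : ℂ) : ℂ := Complex.I * (-z) ^ (1 / 2 : ℂ)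

theorem sqrtUp_sq (z : ℂ) : sqrtUp z ^ 2 = z := by
  have h : ((-z) ^ (1 / 2 : ℂ)) ^ 2 = -z := by
    simp
  rw [sqrtUp, mul_pow, h, Complex.I_sq]
  ring

theorem sqrtUp_im_pos {z : ℂ} (hz : z.re < 0 ∨ z.im ≠ 0) : 0 < (sqrtUp z).im := by
  have hs : -z ∈ Complex.slitPlane := by
    rcases hz with h | h
    · exact Or.inl (by simpa using h)
    · exact Or.inr (by simpa using h)
  have h0 : -z ≠ 0 := Complex.slitPlane_ne_zero hs
  have h1 : (sqrtUp z).im = ((-z) ^ (1 / 2 : ℂ)).re := by simp [sqrtUp]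
  rw [h1, Complex.cpow_def_of_ne_zero h0, Complex.exp_re]
  have h2 : (Complex.log (-z) * (1 / 2)).im = (-z).arg / 2 := by
    rw [show (1 / 2 : ℂ) = ((1 / 2 : ℝ) : ℂ) by norm_num, Complex.im_mul_ofReal, Complex.log_im]
    ring
  rw [h2]
  have h3 := Complex.mem_slitPlane_iff_arg.1 hs
  have h4 : (-z).arg < Real.pi := lt_of_le_of_ne (Complex.arg_le_pi _) h3.1
  have h5 := Complex.neg_pi_lt_arg (-z)
  exact mul_pos (Real.exp_pos _) (Real.cos_pos_of_mem_Ioo ⟨by linarith, by linarith⟩)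

/-! ### The generalized Bäcklund–Darboux transformation of `q ≡ 0` -/

/-- The matrix `J`. -/
def J : Matrix (Fin 2) (Fin 2) ℂ := !![0, 1; -1, 0]

/-- The Darboux matrix `w_A(z) = I₂ + J Λ* S⁻¹ (z Iₙ - A)⁻¹ Λ`. -/
def darbouxMatrix {n : ℕ} (A S : Matrix (Fin n) (Fin n) ℂ) (Λ : Matrix (Fin n) (Fin 2) ℂ) (z : ℂ) :
    Matrix (Fin 2) (Fin 2) ℂ :=
  1 + J * Λᴴ * S⁻¹ * (z • (1 : Matrix (Fin n) (Fin n) ℂ) - A)⁻¹ * Λ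

/-- The transformed potential
`2 ((Λ₂* S⁻¹ Λ₂)² + Λ₁* S⁻¹ Λ₂ + Λ₂* S⁻¹ Λ₁)` for `q ≡ 0`, at one point. -/
def transformedPotential {n : ℕ} (S : Matrix (Fin n) (Fin n) ℂ) (Λ₁ Λ₂ : Fin n → ℂ) : ℂ :=
  2 * ((star Λ₂ ⬝ᵥ (S⁻¹ *ᵥ Λ₂)) ^ 2 + star Λ₁ ⬝ᵥ (S⁻¹ *ᵥ Λ₂) + star Λ₂ ⬝ᵥ (S⁻¹ *ᵥ Λ₁))

/-- The matrix `T(z)`. -/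
def T (z : ℂ) : Matrix (Fin 2) (Fin 2) ℂ :=
  !![1, 1; Complex.I * sqrtUp z, -(Complex.I * sqrtUp z)]

/-- The fundamental matrix `w(z, x) = T(z) diag(e^{i√z x}, e^{-i√z x}) T(z)⁻¹` of `-u'' = z u`;
at `z = 0`, where `T(z)` is singular, it stands for the limit of this expression. -/
def w (z : ℂ) (x : ℝ) : Matrix (Fin 2) (Fin 2) ℂ :=
  if z = 0 then !![1, (x : ℂ); 0, 1]
  else T z * Matrix.diagonal
    ![Complex.exp (Complex.I * sqrtUp z * x), Complex.exp (-(Complex.I * sqrtUp z * x))] * (T z)⁻¹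

/-! ### The case of a `2 × 2` Jordan block -/

/-- The Jordan block with eigenvalue `μ`. -/
def A (μ : ℂ) : Matrix (Fin 2) (Fin 2) ℂ := !![μ, 1; 0, μ]

/-- `ω = i √μ`. -/
def ω (μ : ℂ) : ℂ := Complex.I * sqrtUp μ

/-- The square root `-i ω I₂ + (i / 2ω) N` of the Jordan block. -/
def rootA (μ : ℂ) : Matrix (Fin 2) (Fin 2) ℂ :=
  (-Complex.I * ω μ) • (1 : Matrix (Fin 2) (Fin 2) ℂ) + (Complex.I / (2 * ω μ)) • !![0, 1; 0, 0]

def c₁ (μ : ℂ) (d : ℝ) : ℂ := 1 + d / ω μ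

def c₂ (μ : ℂ) (d : ℝ) : ℂ := 1 - d / ω μ

def c₃ (μ : ℂ) (d : ℝ) : ℂ := c₁ μ d / (2 * ω μ)

def c₄ (μ : ℂ) (d : ℝ) : ℂ := d / (2 * ω μ ^ 3)

def c₅ (μ : ℂ) (d : ℝ) : ℂ := -(c₂ μ d / (2 * ω μ))

/-- `Λ₁(x)`. -/
def Λ₁ (μ : ℂ) (d x : ℝ) : Fin 2 → ℂ :=
  (Complex.I / 2) • (rootA μ *ᵥ
    (Complex.exp (-(ω μ * x)) • ![c₃ μ d * x + c₄ μ d, c₁ μ d] -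
      Complex.exp (ω μ * x) • ![c₅ μ d * x - c₄ μ d, c₂ μ d]))

/-- `Λ₂(x)`. -/
def Λ₂ (μ : ℂ) (d x : ℝ) : Fin 2 → ℂ :=
  (1 / 2 : ℂ) •
    (Complex.exp (-(ω μ * x)) • ![c₃ μ d * x + c₄ μ d, c₁ μ d] +
      Complex.exp (ω μ * x) • ![c₅ μ d * x - c₄ μ d, c₂ μ d])

/-- `Λ(x) = [Λ₁(x) Λ₂(x)]`. -/
def Λ (μ : ℂ) (d x : ℝ) : Matrix (Fin 2) (Fin 2) ℂ :=
  Matrix.of fun i j => ![Λ₁ μ d x i, Λ₂ μ d x i] j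

/-- `S(x) = ∫₀ˣ Λ₂(t) Λ₂(t)* dt`. -/
def S (μ : ℂ) (d x : ℝ) : Matrix (Fin 2) (Fin 2) ℂ :=
  Matrix.of fun i j => ∫ t in (0 : ℝ)..x, Λ₂ μ d t i * conj (Λ₂ μ d t j)

/-- The potential `q̃`. -/
def qTilde (μ : ℂ) (d x : ℝ) : ℂ := transformedPotential (S μ d x) (Λ₁ μ d x) (Λ₂ μ d x)

/-- The row vector `ỹ(z, x) = [1 0] w_A(z, x) w(z, x)`. -/
def yTilde (μ : ℂ) (d : ℝ) (z : ℂ) (x : ℝ) : Fin 2 → ℂ :=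
  ![1, 0] ᵥ* (darbouxMatrix (A μ) (S μ d x) (Λ μ d x) z * w z x)

/-- `M̃(z) = -(z - μ)² (z - μ̄)² (i√z + d)⁻¹`. -/
def MTilde (μ : ℂ) (d : ℝ) (z : ℂ) : ℂ :=
  -((z - μ) ^ 2 * (z - conj μ) ^ 2 * (Complex.I * sqrtUp z + d)⁻¹)

end GBDT

end

namespace GBDT

/-! The proof is a Darboux transformation with a matrix parameter. From `Λ₁' = A Λ₂`, `Λ₂' = -Λ₁`,
`S' = Λ₂ Λ₂*` one gets the identity `A S - S A* = Λ₁ Λ₂* - Λ₂ Λ₁*` (`lyapunov_identity`). It implies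
that `u ↦ u + Λ₂* S⁻¹ v` carries solutions of the free equation to solutions for the new potential,
provided `v' = -u Λ₂` and `(z - A) v = u Λ₁ + u' Λ₂`; the version needed here admits a source term
`Λ₂* k` as well (`isSolution_transform`). The row vector `ỹ` is this transformation applied to the
free fundamental system.

For `θ̃` the factor `(z - μ)²` removes the pole of `(z - A)⁻¹`. For `φ̃` the free solution is `cs -
d sn`. Its value and `z`-derivative at `μ̄` are the conjugates of the two entries of `Λ₂`, and the
transformation annihilates this first-order Taylor polynomial. What is left is `(z - μ̄)²` times the
transform of the second-order remainder `psi`; the division by `(z - μ̄)²` is thereby carried out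
explicitly, which gives an entire function (`cs_sub_eq`, `darbouxMatrix_mulVec_phi`). The Wronskian
is computed from `det w_A = (z - μ̄)² / (z - μ)²`, and reality from the `J`-unitarity of `w_A` for
real `z`.

At the origin the entries of `Λ₂` behave like `-x²/2` and `1`, so `det S ~ x⁶/45`, and direct
expansion gives `12/x²`.

At infinity, `θ̃ + M̃ φ̃` is the transform of a multiple of `e^{i√z x}`. Since `(v* S⁻¹ v)' = |u|² -
|ũ|²` with `v* S⁻¹ v ≥ 0`, it is again square integrable (`integrableOn_transform`). The potential
is bounded on `[1, ∞)` (`exists_norm_qTilde_le`), hence square integrable solutions are proportional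
(`wronskian_eq_zero`), and `M̃` is the Weyl function. -/

/-! ### The linear system for `Λ₁`, `Λ₂` -/

theorem ω_sq (μ : ℂ) : ω μ ^ 2 = -μ := by
  rw [ω, mul_pow, sqrtUp_sq, Complex.I_sq]; ring

theorem ω_ne_zero {μ : ℂ} (hμ : μ ≠ conj μ) : ω μ ≠ 0 := by
  intro h
  have h1 := ω_sq μ
  rw [h] at h1
  have h2 : μ = 0 := by simpa using h1.symm
  exact hμ (by simp [h2])

theorem Λ₁_zero_apply (μ : ℂ) (d x : ℝ) : Λ₁ μ d x 0 = 1 / 2 *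
    (Complex.exp (-(ω μ * x)) * (ω μ * (c₃ μ d * x + c₄ μ d) - c₁ μ d / (2 * ω μ)) -
      Complex.exp (ω μ * x) * (ω μ * (c₅ μ d * x - c₄ μ d) - c₂ μ d / (2 * ω μ))) := by
  simp only [Λ₁, rootA, Matrix.mulVec, dotProduct, Fin.sum_univ_two, Matrix.add_apply,
    Matrix.smul_apply, Matrix.one_apply, Pi.smul_apply, Pi.sub_apply, smul_eq_mul]
  simp
  linear_combination (-(1 / 2) * (Complex.exp (-(ω μ * x)) * (ω μ * (c₃ μ d * x + c₄ μ d)) -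
      Complex.exp (ω μ * x) * (ω μ * (c₅ μ d * x - c₄ μ d))) + 1 / 2 * (ω μ)⁻¹ * (1 / 2) *
      (Complex.exp (-(ω μ * x)) * c₁ μ d - Complex.exp (ω μ * x) * c₂ μ d)) * Complex.I_sq

theorem Λ₁_one_apply (μ : ℂ) (d x : ℝ) : Λ₁ μ d x 1 = 1 / 2 *
    (Complex.exp (-(ω μ * x)) * (ω μ * c₁ μ d) - Complex.exp (ω μ * x) * (ω μ * c₂ μ d)) := by
  simp only [Λ₁, rootA, Matrix.mulVec, dotProduct, Fin.sum_univ_two, Matrix.add_apply,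
    Matrix.smul_apply, Matrix.one_apply, Pi.smul_apply, Pi.sub_apply, smul_eq_mul]
  simp
  linear_combination (-(1 / 2) * (Complex.exp (-(ω μ * x)) * (ω μ * c₁ μ d) -
      Complex.exp (ω μ * x) * (ω μ * c₂ μ d))) * Complex.I_sq

theorem Λ₂_zero_apply (μ : ℂ) (d x : ℝ) : Λ₂ μ d x 0 = 1 / 2 *
    (Complex.exp (-(ω μ * x)) * (c₃ μ d * x + c₄ μ d) +
      Complex.exp (ω μ * x) * (c₅ μ d * x - c₄ μ d)) := by
  simp [Λ₂]

theorem Λ₂_one_apply (μ : ℂ) (d x : ℝ) : Λ₂ μ d x 1 = 1 / 2 *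
    (Complex.exp (-(ω μ * x)) * c₁ μ d + Complex.exp (ω μ * x) * c₂ μ d) := by
  simp [Λ₂]

theorem hasDerivAt_cexp_mul_affine (a b c : ℂ) (x : ℝ) :
    HasDerivAt (fun x : ℝ => Complex.exp (a * x) * (b * x + c))
      (Complex.exp (a * x) * (a * (b * x + c) + b)) x := by
  have h0 : HasDerivAt (fun x : ℝ => (x : ℂ)) 1 x := Complex.ofRealCLM.hasDerivAt
  have h1 := ((h0.const_mul a).cexp).mul ((h0.const_mul b).add_const c)
  refine h1.congr_deriv ?_
  ring

theorem hasDerivAt_fin_two {u : ℝ → Fin 2 → ℂ} {u' : Fin 2 → ℂ} {x : ℝ}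
    (h0 : HasDerivAt (fun x => u x 0) (u' 0) x) (h1 : HasDerivAt (fun x => u x 1) (u' 1) x) :
    HasDerivAt u u' x :=
  hasDerivAt_pi.2 (Fin.forall_fin_two.2 ⟨h0, h1⟩)

theorem hasDerivAt_Λ₂ {μ : ℂ} (hμ : μ ≠ conj μ) (d x : ℝ) :
    HasDerivAt (Λ₂ μ d) (-Λ₁ μ d x) x := by
  have hω := ω_ne_zero hμ
  apply hasDerivAt_fin_two
  · have h1 := hasDerivAt_cexp_mul_affine (-ω μ) (c₃ μ d) (c₄ μ d) x
    have h2 := hasDerivAt_cexp_mul_affine (ω μ) (c₅ μ d) (-c₄ μ d) x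
    have h3 := (h1.add h2).const_mul (1 / 2)
    refine (h3.congr_deriv ?_).congr_of_eventuallyEq (Eventually.of_forall fun y => ?_)
    · rw [Pi.neg_apply, Λ₁_zero_apply]
      simp only [c₃, c₅, neg_mul]
      field_simp
      ring
    · simp [Λ₂_zero_apply, sub_eq_add_neg]
  · have h1 := hasDerivAt_cexp_mul_affine (-ω μ) 0 (c₁ μ d) x
    have h2 := hasDerivAt_cexp_mul_affine (ω μ) 0 (c₂ μ d) x
    have h3 := (h1.add h2).const_mul (1 / 2)
    refine (h3.congr_deriv ?_).congr_of_eventuallyEq (Eventually.of_forall fun y => ?_)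
    · rw [Pi.neg_apply, Λ₁_one_apply]
      simp only [neg_mul]
      ring
    · simp [Λ₂_one_apply]

theorem A_mulVec (μ : ℂ) (v : Fin 2 → ℂ) : A μ *ᵥ v = ![μ * v 0 + v 1, μ * v 1] := by
  ext i; fin_cases i <;> simp [A, Matrix.mulVec, dotProduct, Fin.sum_univ_two]

theorem hasDerivAt_Λ₁ {μ : ℂ} (hμ : μ ≠ conj μ) (d x : ℝ) :
    HasDerivAt (Λ₁ μ d) (A μ *ᵥ Λ₂ μ d x) x := by
  have hω := ω_ne_zero hμ
  have hμω : μ = -ω μ ^ 2 := by rw [ω_sq, neg_neg]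
  rw [A_mulVec]
  apply hasDerivAt_fin_two
  · have h1 := hasDerivAt_cexp_mul_affine (-ω μ) (ω μ * c₃ μ d)
      (ω μ * c₄ μ d - c₁ μ d / (2 * ω μ)) x
    have h2 := hasDerivAt_cexp_mul_affine (ω μ) (ω μ * c₅ μ d)
      (-(ω μ * c₄ μ d) - c₂ μ d / (2 * ω μ)) x
    have h3 := (h1.sub h2).const_mul (1 / 2)
    refine (h3.congr_deriv ?_).congr_of_eventuallyEq (Eventually.of_forall fun y => ?_)
    · simp only [Matrix.cons_val_zero, Λ₂_zero_apply, Λ₂_one_apply]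
      rw [show μ * (1 / 2 * (Complex.exp (-(ω μ * x)) * (c₃ μ d * x + c₄ μ d) +
        Complex.exp (ω μ * x) * (c₅ μ d * x - c₄ μ d))) = -ω μ ^ 2 * (1 / 2 *
        (Complex.exp (-(ω μ * x)) * (c₃ μ d * x + c₄ μ d) +
        Complex.exp (ω μ * x) * (c₅ μ d * x - c₄ μ d))) by rw [← hμω]]
      simp only [c₃, c₅, neg_mul]
      field_simp
      ring
    · simp only [Λ₁_zero_apply, Pi.sub_apply, neg_mul]
      ring
  · have h1 := hasDerivAt_cexp_mul_affine (-ω μ) 0 (ω μ * c₁ μ d) x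
    have h2 := hasDerivAt_cexp_mul_affine (ω μ) 0 (ω μ * c₂ μ d) x
    have h3 := (h1.sub h2).const_mul (1 / 2)
    refine (h3.congr_deriv ?_).congr_of_eventuallyEq (Eventually.of_forall fun y => ?_)
    · change _ = μ * Λ₂ μ d x 1
      simp only [Λ₂_one_apply, neg_mul]
      linear_combination (-(1 / 2 * (Complex.exp (-(ω μ * x)) * c₁ μ d +
        Complex.exp (ω μ * x) * c₂ μ d))) * hμω
    · simp [Λ₁_one_apply]

theorem Λ₂_at_zero (μ : ℂ) (d : ℝ) : Λ₂ μ d 0 = ![0, 1] := by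
  ext i
  fin_cases i
  · simp [Λ₂_zero_apply]
  · simp [Λ₂_one_apply, c₁, c₂]; norm_num

theorem Λ₁_at_zero {μ : ℂ} (hμ : μ ≠ conj μ) (d : ℝ) : Λ₁ μ d 0 = ![0, (d : ℂ)] := by
  have hω := ω_ne_zero hμ
  ext i
  fin_cases i
  · simp [Λ₁_zero_apply, c₁, c₂, c₄]
    field_simp
    ring
  · simp [Λ₁_one_apply, c₁, c₂]
    field_simp
    ring

theorem hasDerivAt_Λ₂_apply {μ : ℂ} (hμ : μ ≠ conj μ) (d x : ℝ) (i : Fin 2) :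
    HasDerivAt (fun x => Λ₂ μ d x i) (-Λ₁ μ d x i) x :=
  hasDerivAt_pi.1 (hasDerivAt_Λ₂ hμ d x) i

theorem hasDerivAt_Λ₁_zero {μ : ℂ} (hμ : μ ≠ conj μ) (d x : ℝ) :
    HasDerivAt (fun x => Λ₁ μ d x 0) (μ * Λ₂ μ d x 0 + Λ₂ μ d x 1) x :=
  (hasDerivAt_pi.1 (hasDerivAt_Λ₁ hμ d x) 0).congr_deriv (by rw [A_mulVec]; rfl)

theorem hasDerivAt_Λ₁_one {μ : ℂ} (hμ : μ ≠ conj μ) (d x : ℝ) :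
    HasDerivAt (fun x => Λ₁ μ d x 1) (μ * Λ₂ μ d x 1) x :=
  (hasDerivAt_pi.1 (hasDerivAt_Λ₁ hμ d x) 1).congr_deriv (by rw [A_mulVec]; rfl)

theorem continuous_Λ₂_apply {μ : ℂ} (hμ : μ ≠ conj μ) (d : ℝ) (i : Fin 2) :
    Continuous fun x => Λ₂ μ d x i :=
  continuous_iff_continuousAt.2 fun x => (hasDerivAt_Λ₂_apply hμ d x i).continuousAt

theorem continuous_Λ₁_apply {μ : ℂ} (hμ : μ ≠ conj μ) (d : ℝ) (i : Fin 2) :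
    Continuous fun x => Λ₁ μ d x i :=
  continuous_iff_continuousAt.2 fun x =>
    (hasDerivAt_pi.1 (hasDerivAt_Λ₁ hμ d x) i).continuousAt

theorem hasDerivAt_conj_comp {f : ℝ → ℂ} {f' : ℂ} {x : ℝ} (h : HasDerivAt f f' x) :
    HasDerivAt (fun x => conj (f x)) (conj f') x :=
  HasDerivAt.star h

/-- Two functions on the line with the same derivative and the same value at `0` coincide. -/
theorem eq_of_hasDerivAt_eq {f g f' : ℝ → ℂ} (hf : ∀ x, HasDerivAt f (f' x) x)
    (hg : ∀ x, HasDerivAt g (f' x) x) (h0 : f 0 = g 0) (x : ℝ) : f x = g x := by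
  have h : ∀ y, HasDerivAt (fun y => f y - g y) 0 y := fun y =>
    ((hf y).sub (hg y)).congr_deriv (sub_self _)
  have h1 := is_const_of_deriv_eq_zero (fun y => (h y).differentiableAt)
    (fun y => (h y).deriv) x 0
  simp only [h0, sub_self] at h1
  exact sub_eq_zero.1 h1

/-! ### The matrix `S`: positivity, Lyapunov identity, derivative of the inverse -/

theorem S_apply (μ : ℂ) (d x : ℝ) (i j : Fin 2) :
    S μ d x i j = ∫ t in (0 : ℝ)..x, Λ₂ μ d t i * conj (Λ₂ μ d t j) := rfl

theorem hasDerivAt_S_apply {μ : ℂ} (hμ : μ ≠ conj μ) (d x : ℝ) (i j : Fin 2) :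
    HasDerivAt (fun x => S μ d x i j) (Λ₂ μ d x i * conj (Λ₂ μ d x j)) x := by
  have hc : Continuous fun t => Λ₂ μ d t i * conj (Λ₂ μ d t j) :=
    (continuous_Λ₂_apply hμ d i).mul (Complex.continuous_conj.comp (continuous_Λ₂_apply hμ d j))
  exact intervalIntegral.integral_hasDerivAt_right (hc.intervalIntegrable _ _)
    (hc.stronglyMeasurableAtFilter _ _) hc.continuousAt

theorem S_at_zero (μ : ℂ) (d : ℝ) (i j : Fin 2) : S μ d 0 i j = 0 := by simp [S_apply]

theorem conj_S_apply {μ : ℂ} (hμ : μ ≠ conj μ) (d x : ℝ) (i j : Fin 2) :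
    conj (S μ d x i j) = S μ d x j i := by
  refine eq_of_hasDerivAt_eq (f := fun x => conj (S μ d x i j)) (f' := fun x => Λ₂ μ d x j * conj (Λ₂ μ d x i))
    (fun y => ?_) (fun y => hasDerivAt_S_apply hμ d y j i) (by simp [S_at_zero]) x
  refine (hasDerivAt_conj_comp (hasDerivAt_S_apply hμ d y i j)).congr_deriv ?_
  simp [mul_comm]

theorem S_isHermitian {μ : ℂ} (hμ : μ ≠ conj μ) (d x : ℝ) : (S μ d x).IsHermitian := by
  ext i j
  exact conj_S_apply hμ d x j i

/-- The quadratic form of `S(x)` is the square of an `L²` norm. -/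
theorem quadratic_form_S {μ : ℂ} (hμ : μ ≠ conj μ) (d x : ℝ) (η : Fin 2 → ℂ) :
    star η ⬝ᵥ (S μ d x *ᵥ η) =
      ((∫ t in (0 : ℝ)..x, ‖star η ⬝ᵥ Λ₂ μ d t‖ ^ 2 : ℝ) : ℂ) := by
  have hc : Continuous fun t => star η ⬝ᵥ Λ₂ μ d t := by
    simp only [dotProduct, Fin.sum_univ_two]
    exact (continuous_const.mul (continuous_Λ₂_apply hμ d 0)).add
      (continuous_const.mul (continuous_Λ₂_apply hμ d 1))
  have hc2 : Continuous fun t => ‖star η ⬝ᵥ Λ₂ μ d t‖ ^ 2 := by fun_prop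
  refine eq_of_hasDerivAt_eq (f := fun x => star η ⬝ᵥ (S μ d x *ᵥ η))
    (g := fun x => ((∫ t in (0 : ℝ)..x, ‖star η ⬝ᵥ Λ₂ μ d t‖ ^ 2 : ℝ) : ℂ))
    (f' := fun y => ((‖star η ⬝ᵥ Λ₂ μ d y‖ ^ 2 : ℝ) : ℂ)) (fun y => ?_) (fun y => ?_) ?_ x
  · simp only [dotProduct, Matrix.mulVec, Fin.sum_univ_two]
    have h := fun i j => hasDerivAt_S_apply hμ d y i j
    refine (((((h 0 0).mul_const (η 0)).add ((h 0 1).mul_const (η 1))).const_mul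
      (star η 0)).add ((((h 1 0).mul_const (η 0)).add ((h 1 1).mul_const (η 1))).const_mul
      (star η 1))).congr_deriv ?_
    push_cast
    rw [← Complex.mul_conj']
    simp
    ring
  · exact HasDerivAt.ofReal_comp (intervalIntegral.integral_hasDerivAt_right
      (hc2.intervalIntegrable _ _) (hc2.stronglyMeasurableAtFilter _ _) hc2.continuousAt)
  · simp [dotProduct, Matrix.mulVec, Fin.sum_univ_two, S_at_zero]

/-- A null vector `η` of the quadratic form would make `η* Λ₂` vanish on `[0, x]`. The value at `0`
kills the second entry of `η`; then the first entry of `Λ₂` vanishes on the interval, and two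
differentiations carry this over to the second entry, which equals `1` at `0`. -/
theorem S_posDef {μ : ℂ} (hμ : μ ≠ conj μ) (d : ℝ) {x : ℝ} (hx : 0 < x) :
    (S μ d x).PosDef := by
  refine Matrix.PosDef.of_dotProduct_mulVec_pos (S_isHermitian hμ d x) fun η hη => ?_
  rw [quadratic_form_S hμ, Complex.zero_lt_real]
  have hc : Continuous fun t => star η ⬝ᵥ Λ₂ μ d t := by
    simp only [dotProduct, Fin.sum_univ_two]
    exact (continuous_const.mul (continuous_Λ₂_apply hμ d 0)).add
      (continuous_const.mul (continuous_Λ₂_apply hμ d 1))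
  refine intervalIntegral.integral_pos hx ((hc.norm.pow 2).continuousOn) (fun t _ => by positivity) ?_
  by_contra! hcon
  have hz : ∀ t ∈ Icc 0 x, star η ⬝ᵥ Λ₂ μ d t = 0 := fun t ht => by
    have h1 := hcon t ht
    have h2 : ‖star η ⬝ᵥ Λ₂ μ d t‖ ^ 2 = 0 := le_antisymm h1 (by positivity)
    simpa using h2
  have h1 : η 1 = 0 := by
    have := hz 0 ⟨le_rfl, hx.le⟩
    rw [Λ₂_at_zero] at this
    simpa [dotProduct, Fin.sum_univ_two] using this
  have h0 : η 0 ≠ 0 := fun h0 => hη (by ext i; fin_cases i <;> simp [h0, h1])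
  have hf : ∀ t ∈ Ioo 0 x, Λ₂ μ d t 0 = 0 := fun t ht => by
    have := hz t (Ioo_subset_Icc_self ht)
    simpa [dotProduct, Fin.sum_univ_two, h1, h0] using this
  have hf1 : ∀ t ∈ Ioo 0 x, Λ₁ μ d t 0 = 0 := fun t ht => by
    have e : (fun t => Λ₂ μ d t 0) =ᶠ[𝓝 t] fun _ => 0 := by
      filter_upwards [isOpen_Ioo.mem_nhds ht] with s hs using hf s hs
    have := (hasDerivAt_Λ₂_apply hμ d t 0).unique ((hasDerivAt_const t 0).congr_of_eventuallyEq e)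
    simpa using this
  have hg : ∀ t ∈ Ioo 0 x, Λ₂ μ d t 1 = 0 := fun t ht => by
    have e : (fun t => Λ₁ μ d t 0) =ᶠ[𝓝 t] fun _ => 0 := by
      filter_upwards [isOpen_Ioo.mem_nhds ht] with s hs using hf1 s hs
    have := (hasDerivAt_Λ₁_zero hμ d t).unique ((hasDerivAt_const t 0).congr_of_eventuallyEq e)
    simpa [hf t ht] using this
  have hl : Tendsto (fun t => Λ₂ μ d t 1) (𝓝[>] 0) (𝓝 (Λ₂ μ d 0 1)) :=
    ((continuous_Λ₂_apply hμ d 1).tendsto 0).mono_left nhdsWithin_le_nhds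
  have hl0 : Tendsto (fun t => Λ₂ μ d t 1) (𝓝[>] 0) (𝓝 0) :=
    tendsto_const_nhds.congr' (by
      filter_upwards [Ioo_mem_nhdsGT hx] with t ht using (hg t ht).symm)
  have := tendsto_nhds_unique hl hl0
  simp [Λ₂_at_zero] at this

/-- Both sides have derivative `A Λ₂ Λ₂* - Λ₂ Λ₂* A*`, the terms `Λ₁ Λ₁*` cancelling. Both vanish at
`0`: there `Λ₁ = d Λ₂`, and `d` is real. -/
theorem lyapunov_identity {μ : ℂ} (hμ : μ ≠ conj μ) (d x : ℝ) :
    A μ * S μ d x - S μ d x * (A μ)ᴴ = Matrix.vecMulVec (Λ₁ μ d x) (star (Λ₂ μ d x)) -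
      Matrix.vecMulVec (Λ₂ μ d x) (star (Λ₁ μ d x)) := by
  have hS := fun (y : ℝ) i j => hasDerivAt_S_apply hμ d y i j
  have h2 := fun (y : ℝ) i => hasDerivAt_Λ₂_apply hμ d y i
  have h10 := fun (y : ℝ) => hasDerivAt_Λ₁_zero hμ d y
  have h11 := fun (y : ℝ) => hasDerivAt_Λ₁_one hμ d y
  ext i j
  fin_cases i <;> fin_cases j <;>
    simp [A, Matrix.mul_apply, Matrix.vecMul, dotProduct, Fin.sum_univ_two, Matrix.vecMulVec_apply, Matrix.conjTranspose_apply]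
  · refine eq_of_hasDerivAt_eq
      (fun y => (((hS y 0 0).const_mul μ).add (hS y 1 0)).sub
        (((hS y 0 0).mul_const (conj μ)).add (hS y 0 1)))
      (fun y => (((h10 y).mul (hasDerivAt_conj_comp (h2 y 0))).sub
        ((h2 y 0).mul (hasDerivAt_conj_comp (h10 y)))).congr_deriv ?_) ?_ x
    · simp; ring
    · simp [S_at_zero, Λ₂_at_zero, Λ₁_at_zero hμ]
  · refine eq_of_hasDerivAt_eq
      (fun y => (((hS y 0 1).const_mul μ).add (hS y 1 1)).sub
        ((hS y 0 1).mul_const (conj μ)))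
      (fun y => (((h10 y).mul (hasDerivAt_conj_comp (h2 y 1))).sub
        ((h2 y 0).mul (hasDerivAt_conj_comp (h11 y)))).congr_deriv ?_) ?_ x
    · simp; ring
    · simp [S_at_zero, Λ₂_at_zero, Λ₁_at_zero hμ]
  · refine eq_of_hasDerivAt_eq
      (fun y => ((hS y 1 0).const_mul μ).sub
        (((hS y 1 0).mul_const (conj μ)).add (hS y 1 1)))
      (fun y => (((h11 y).mul (hasDerivAt_conj_comp (h2 y 0))).sub
        ((h2 y 1).mul (hasDerivAt_conj_comp (h10 y)))).congr_deriv ?_) ?_ x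
    · simp; ring
    · simp [S_at_zero, Λ₂_at_zero, Λ₁_at_zero hμ]
  · refine eq_of_hasDerivAt_eq
      (fun y => ((hS y 1 1).const_mul μ).sub ((hS y 1 1).mul_const (conj μ)))
      (fun y => (((h11 y).mul (hasDerivAt_conj_comp (h2 y 1))).sub
        ((h2 y 1).mul (hasDerivAt_conj_comp (h11 y)))).congr_deriv ?_) ?_ x
    · simp; ring
    · simp [S_at_zero, Λ₂_at_zero, Λ₁_at_zero hμ]

theorem det_S_ne_zero {μ : ℂ} (hμ : μ ≠ conj μ) (d : ℝ) {x : ℝ} (hx : 0 < x) :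
    (S μ d x).det ≠ 0 := (S_posDef hμ d hx).det_pos.ne'

theorem inv_S_mul {μ : ℂ} (hμ : μ ≠ conj μ) (d : ℝ) {x : ℝ} (hx : 0 < x) :
    (S μ d x)⁻¹ * S μ d x = 1 :=
  Matrix.nonsing_inv_mul _ (isUnit_iff_ne_zero.2 (det_S_ne_zero hμ d hx))

theorem S_mul_inv {μ : ℂ} (hμ : μ ≠ conj μ) (d : ℝ) {x : ℝ} (hx : 0 < x) :
    S μ d x * (S μ d x)⁻¹ = 1 :=
  Matrix.mul_nonsing_inv _ (isUnit_iff_ne_zero.2 (det_S_ne_zero hμ d hx))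

theorem inv_S_isHermitian {μ : ℂ} (hμ : μ ≠ conj μ) (d x : ℝ) : ((S μ d x)⁻¹).IsHermitian :=
  (S_isHermitian hμ d x).inv

theorem inv_S_apply (μ : ℂ) (d x : ℝ) : (S μ d x)⁻¹ = (S μ d x).det⁻¹ •
    !![S μ d x 1 1, -S μ d x 0 1; -S μ d x 1 0, S μ d x 0 0] := by
  rw [Matrix.inv_def, Matrix.adjugate_fin_two, Ring.inverse_eq_inv']

theorem hasDerivAt_det_S {μ : ℂ} (hμ : μ ≠ conj μ) (d x : ℝ) :
    HasDerivAt (fun x => (S μ d x).det)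
      (Λ₂ μ d x 0 * conj (Λ₂ μ d x 0) * S μ d x 1 1 + S μ d x 0 0 * (Λ₂ μ d x 1 *
        conj (Λ₂ μ d x 1)) - (Λ₂ μ d x 0 * conj (Λ₂ μ d x 1) * S μ d x 1 0 + S μ d x 0 1 *
        (Λ₂ μ d x 1 * conj (Λ₂ μ d x 0)))) x := by
  have hS := fun i j => hasDerivAt_S_apply hμ d x i j
  simp only [Matrix.det_fin_two]
  exact ((hS 0 0).mul (hS 1 1)).sub ((hS 0 1).mul (hS 1 0))

/-- `(S⁻¹)' = -S⁻¹ Λ₂ Λ₂* S⁻¹`. -/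
theorem hasDerivAt_inv_S_apply {μ : ℂ} (hμ : μ ≠ conj μ) (d : ℝ) {x : ℝ} (hx : 0 < x)
    (i j : Fin 2) : HasDerivAt (fun x => (S μ d x)⁻¹ i j)
      (-((((S μ d x)⁻¹ *ᵥ Λ₂ μ d x) i) * ((star (Λ₂ μ d x) ᵥ* (S μ d x)⁻¹) j))) x := by
  have hS := fun i j => hasDerivAt_S_apply hμ d x i j
  have hd := (hasDerivAt_det_S hμ d x).inv (det_S_ne_zero hμ d hx)
  have h0 := det_S_ne_zero hμ d hx
  have e : (fun x => (S μ d x)⁻¹ i j) = fun x => (S μ d x).det⁻¹ *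
      !![S μ d x 1 1, -S μ d x 0 1; -S μ d x 1 0, S μ d x 0 0] i j := by
    ext y; rw [inv_S_apply]; rfl
  rw [e]
  simp only [inv_S_apply]
  rw [Matrix.det_fin_two] at h0
  fin_cases i <;> fin_cases j
  · refine (hd.mul (hS 1 1)).congr_deriv ?_
    simp [Matrix.mulVec, Matrix.vecMul, dotProduct, Fin.sum_univ_two, Matrix.det_fin_two]
    field_simp
    ring
  · refine (hd.mul (hS 0 1).neg).congr_deriv ?_
    simp [Matrix.mulVec, Matrix.vecMul, dotProduct, Fin.sum_univ_two, Matrix.det_fin_two]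
    field_simp
    ring
  · refine (hd.mul (hS 1 0).neg).congr_deriv ?_
    simp [Matrix.mulVec, Matrix.vecMul, dotProduct, Fin.sum_univ_two, Matrix.det_fin_two]
    field_simp
    ring
  · refine (hd.mul (hS 0 0)).congr_deriv ?_
    simp [Matrix.mulVec, Matrix.vecMul, dotProduct, Fin.sum_univ_two, Matrix.det_fin_two]
    field_simp
    ring

/-! ### The free equation: solutions entire in `z`, and the fundamental matrix -/

/-- The entire function `ζ ↦ cos √ζ`. -/
noncomputable def cosSqrt (ζ : ℂ) : ℂ := ∑' n : ℕ, (-1) ^ n * ζ ^ n / ((2 * n).factorial : ℂ)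

/-- The entire function `ζ ↦ sin √ζ / √ζ`. -/
noncomputable def sincSqrt (ζ : ℂ) : ℂ := ∑' n : ℕ, (-1) ^ n * ζ ^ n / ((2 * n + 1).factorial : ℂ)

theorem cosSqrt_sq (r : ℂ) : cosSqrt (r ^ 2) = Complex.cos r := by
  rw [cosSqrt, ← (Complex.hasSum_cos r).tsum_eq]
  simp only [pow_mul]

theorem mul_sincSqrt_sq (r : ℂ) : r * sincSqrt (r ^ 2) = Complex.sin r := by
  rw [sincSqrt, ← (Complex.hasSum_sin r).tsum_eq, ← tsum_mul_left]
  refine tsum_congr fun n => ?_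
  rw [pow_succ r (2 * n), pow_mul]
  ring

/-- The exponential series is a locally uniform majorant because `k n ≥ n`. -/
theorem differentiable_tsum_pow_div (k : ℕ → ℕ) (hk : ∀ n, n ≤ k n) :
    Differentiable ℂ fun ζ : ℂ => ∑' n : ℕ, (-1) ^ n * ζ ^ n / ((k n).factorial : ℂ) := by
  intro ζ
  have hs : Summable fun n : ℕ => (‖ζ‖ + 1) ^ n / (n.factorial : ℝ) :=
    Real.summable_pow_div_factorial _
  have hd := Complex.differentiableOn_tsum_of_summable_norm
    (F := fun (n : ℕ) (ζ : ℂ) => (-1) ^ n * ζ ^ n / ((k n).factorial : ℂ)) hs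
    (fun n => by fun_prop) (Metric.isOpen_ball (x := (0 : ℂ)) (ε := ‖ζ‖ + 1)) ?_
  · exact hd.differentiableAt (Metric.isOpen_ball.mem_nhds (by simp))
  · intro n w hw
    have hw' : ‖w‖ ≤ ‖ζ‖ + 1 := by simpa using (mem_ball_zero_iff.1 hw).le
    simp only [norm_div, norm_mul, norm_pow, norm_neg, norm_one, one_pow, one_mul,
      Complex.norm_natCast]
    have : (n.factorial : ℝ) ≤ ((k n).factorial : ℝ) := by
      exact_mod_cast Nat.factorial_le (hk n)
    have h0 : (0 : ℝ) < n.factorial := by exact_mod_cast n.factorial_pos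
    gcongr

theorem differentiable_cosSqrt : Differentiable ℂ cosSqrt :=
  differentiable_tsum_pow_div (fun n => 2 * n) fun n => by omega

theorem differentiable_sincSqrt : Differentiable ℂ sincSqrt :=
  differentiable_tsum_pow_div (fun n => 2 * n + 1) fun n => by omega

theorem cosSqrt_zero : cosSqrt 0 = 1 := by
  simpa using cosSqrt_sq 0

theorem sincSqrt_zero : sincSqrt 0 = 1 := by
  rw [sincSqrt, tsum_eq_single 0 (fun n hn => by simp [hn])]
  simp

theorem conj_cosSqrt (ζ : ℂ) : conj (cosSqrt ζ) = cosSqrt (conj ζ) := by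
  simp [cosSqrt, Complex.conj_tsum]

theorem conj_sincSqrt (ζ : ℂ) : conj (sincSqrt ζ) = sincSqrt (conj ζ) := by
  simp [sincSqrt, Complex.conj_tsum]

/-- The solution `cos(√z x)` of `-u'' = z u`. -/
noncomputable def cs (z : ℂ) (x : ℝ) : ℂ := cosSqrt (z * x ^ 2)

/-- The solution `sin(√z x) / √z` of `-u'' = z u`. -/
noncomputable def sn (z : ℂ) (x : ℝ) : ℂ := x * sincSqrt (z * x ^ 2)

theorem cs_sq (r : ℂ) (x : ℝ) : cs (r ^ 2) x = Complex.cos (r * x) := by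
  rw [cs, ← mul_pow, cosSqrt_sq]

theorem mul_sn_sq (r : ℂ) (x : ℝ) : r * sn (r ^ 2) x = Complex.sin (r * x) := by
  rw [sn, ← mul_pow, ← mul_sincSqrt_sq]; ring

theorem hasDerivAt_cs (z : ℂ) (x : ℝ) : HasDerivAt (cs z) (-z * sn z x) x := by
  obtain ⟨r, rfl⟩ : ∃ r, r ^ 2 = z := ⟨_, sqrtUp_sq z⟩
  have h0 : HasDerivAt (fun x : ℝ => (x : ℂ)) 1 x := Complex.ofRealCLM.hasDerivAt
  have h := (Complex.hasDerivAt_cos (r * x)).comp x (h0.const_mul r)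
  have e : cs (r ^ 2) = fun x : ℝ => Complex.cos (r * x) := funext (cs_sq r)
  rw [e]
  refine h.congr_deriv ?_
  rw [← mul_sn_sq]; ring

theorem hasDerivAt_sn (z : ℂ) (x : ℝ) : HasDerivAt (sn z) (cs z x) x := by
  have h0 : HasDerivAt (fun x : ℝ => (x : ℂ)) 1 x := Complex.ofRealCLM.hasDerivAt
  by_cases hz : z = 0
  · subst hz
    have e : sn 0 = fun x : ℝ => (x : ℂ) := by ext y; simp [sn, sincSqrt_zero]
    simpa [e, cs, cosSqrt_zero] using h0
  · obtain ⟨r, rfl⟩ : ∃ r, r ^ 2 = z := ⟨_, sqrtUp_sq z⟩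
    have hr : r ≠ 0 := fun h => hz (by simp [h])
    have h := ((Complex.hasDerivAt_sin (r * x)).comp x (h0.const_mul r)).const_mul r⁻¹
    have e : sn (r ^ 2) = fun x : ℝ => r⁻¹ * Complex.sin (r * x) := by
      ext y; rw [← mul_sn_sq]; field_simp
    rw [e, cs_sq]
    refine h.congr_deriv ?_
    field_simp

@[simp] theorem cs_at_zero (z : ℂ) : cs z 0 = 1 := by simp [cs, cosSqrt_zero]

@[simp] theorem sn_at_zero (z : ℂ) : sn z 0 = 0 := by simp [sn]

theorem cs_sq_add (z : ℂ) (x : ℝ) : cs z x ^ 2 + z * sn z x ^ 2 = 1 := by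
  obtain ⟨r, rfl⟩ : ∃ r, r ^ 2 = z := ⟨_, sqrtUp_sq z⟩
  rw [← mul_pow, mul_sn_sq, cs_sq, Complex.cos_sq_add_sin_sq]

theorem conj_cs (z : ℂ) (x : ℝ) : conj (cs z x) = cs (conj z) x := by
  simp [cs, conj_cosSqrt]

theorem conj_sn (z : ℂ) (x : ℝ) : conj (sn z x) = sn (conj z) x := by
  simp [sn, conj_sincSqrt]

theorem differentiable_cs (x : ℝ) : Differentiable ℂ fun z => cs z x :=
  differentiable_cosSqrt.comp (differentiable_id.mul_const _)

theorem differentiable_sn (x : ℝ) : Differentiable ℂ fun z => sn z x :=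
  (differentiable_sincSqrt.comp (differentiable_id.mul_const _)).const_mul _

theorem continuous_cs : Continuous fun p : ℂ × ℝ => cs p.1 p.2 := by
  have h := differentiable_cosSqrt.continuous
  unfold cs
  fun_prop

theorem continuous_sn : Continuous fun p : ℂ × ℝ => sn p.1 p.2 := by
  have h := differentiable_sincSqrt.continuous
  unfold sn
  fun_prop

theorem continuous_cs_right (z : ℂ) : Continuous (cs z) :=
  continuous_iff_continuousAt.2 fun x => (hasDerivAt_cs z x).continuousAt

theorem continuous_sn_right (z : ℂ) : Continuous (sn z) :=
  continuous_iff_continuousAt.2 fun x => (hasDerivAt_sn z x).continuousAt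

/-- Uniqueness for the initial value problem of `-u'' = z u`. -/
theorem eq_zero_of_hasDerivAt {z : ℂ} {u u' : ℝ → ℂ} (hu : ∀ x, HasDerivAt u (u' x) x)
    (hu' : ∀ x, HasDerivAt u' (-z * u x) x) (h0 : u 0 = 0) (h0' : u' 0 = 0) (x : ℝ) :
    u x = 0 := by
  -- Undoing the free evolution turns `(u, u')` into two constants, `h1` and `h2`; `cs² + z sn² = 1`
  -- then recovers `u`.
  have h1 := eq_of_hasDerivAt_eq (f := fun x => u x * cs z x - u' x * sn z x) (g := fun _ => 0)
    (f' := fun x => 0)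
    (fun y => (((hu y).mul (hasDerivAt_cs z y)).sub ((hu' y).mul (hasDerivAt_sn z y))).congr_deriv
      (by ring)) (fun y => hasDerivAt_const y _) (by simp [h0]) x
  have h2 := eq_of_hasDerivAt_eq (f := fun x => u x * (z * sn z x) + u' x * cs z x)
    (g := fun _ => 0) (f' := fun x => 0)
    (fun y => (((hu y).mul ((hasDerivAt_sn z y).const_mul z)).add
      ((hu' y).mul (hasDerivAt_cs z y))).congr_deriv
      (by ring)) (fun y => hasDerivAt_const y _) (by simp [h0']) x
  linear_combination (-u x) * cs_sq_add z x + cs z x * h1 + sn z x * h2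

/-- The fundamental matrix in terms of `cs` and `sn`. -/
theorem w_eq (z : ℂ) (x : ℝ) : w z x = !![cs z x, sn z x; -z * sn z x, cs z x] := by
  by_cases hz : z = 0
  · subst hz
    simp [w, cs, sn, cosSqrt_zero, sincSqrt_zero]
  · set r := sqrtUp z with hr
    have hrz : r ^ 2 = z := sqrtUp_sq z
    have hr0 : r ≠ 0 := fun h => hz (by rw [← hrz, h]; simp)
    have hdet : (T z).det ≠ 0 := by
      rw [T, Matrix.det_fin_two_of, ← hr]
      intro h
      have : Complex.I * r = 0 := by linear_combination (-1 / 2) * h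
      simp [hr0] at this
    have hu : IsUnit (T z).det := isUnit_iff_ne_zero.2 hdet
    rw [w, if_neg hz]
    have e1 : Complex.exp (Complex.I * r * x) = cs z x + Complex.I * (r * sn z x) := by
      rw [← hrz, cs_sq, mul_sn_sq, mul_assoc, mul_comm Complex.I, Complex.exp_mul_I]
      ring
    have e2 : Complex.exp (-(Complex.I * r * x)) = cs z x - Complex.I * (r * sn z x) := by
      rw [← hrz, cs_sq, mul_sn_sq, show -(Complex.I * r * (x : ℂ)) = -(r * x) * Complex.I by ring,
        Complex.exp_mul_I, Complex.cos_neg, Complex.sin_neg]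
      ring
    -- Comparing after multiplication by `T z` on the right avoids computing its inverse.
    have key : T z * Matrix.diagonal ![Complex.exp (Complex.I * r * x),
        Complex.exp (-(Complex.I * r * x))] =
        !![cs z x, sn z x; -z * sn z x, cs z x] * T z := by
      rw [e1, e2, T, ← hr]
      ext i j
      fin_cases i <;> fin_cases j <;> simp [Matrix.mul_apply, Fin.sum_univ_two]
      · ring
      · ring
      · linear_combination (r ^ 2 * sn z x) * Complex.I_sq - sn z x * hrz
      · linear_combination (r ^ 2 * sn z x) * Complex.I_sq - sn z x * hrz
    rw [key, Matrix.mul_nonsing_inv_cancel_right _ _ hu]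

/-! ### The remainder `psi` at the point `μ̄` -/

/-- An integral of a family of entire functions that depends continuously on the parameter is
entire. -/
theorem differentiable_intervalIntegral {F : ℂ → ℝ → ℂ}
    (hc : Continuous fun p : ℂ × ℝ => F p.1 p.2) (hd : ∀ t, Differentiable ℂ fun z => F z t)
    (a b : ℝ) : Differentiable ℂ fun z => ∫ t in a..b, F z t := by
  intro z₀
  have hcz : ∀ z, Continuous (F z) := fun z =>
    hc.comp (by fun_prop : Continuous fun t : ℝ => (z, t))
  -- Radius `2` contains every unit circle centred in the unit ball about `z₀`, so that Cauchy's
  -- estimate bounds the derivative by `C` on that ball.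
  obtain ⟨C, hC⟩ := ((isCompact_closedBall z₀ 2).prod (isCompact_uIcc (a := a) (b := b))
    ).exists_bound_of_continuousOn hc.continuousOn
  have hm : Measurable fun t : ℝ => deriv (fun z => F z t) z₀ := by
    have h := measurable_deriv_with_param (f := fun (t : ℝ) (z : ℂ) => F z t)
      (hc.comp continuous_swap)
    exact h.comp (by fun_prop : Measurable fun t : ℝ => (t, z₀))
  refine (intervalIntegral.hasDerivAt_integral_of_dominated_loc_of_deriv_le
    (F' := fun z t => deriv (fun z => F z t) z) (bound := fun _ => C)
    (Metric.ball_mem_nhds z₀ one_pos)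
    (Eventually.of_forall fun z => (hcz z).aestronglyMeasurable)
    ((hcz z₀).intervalIntegrable _ _) hm.aestronglyMeasurable
    (Eventually.of_forall fun t ht z hz => ?_) intervalIntegrable_const
    (Eventually.of_forall fun t _ z _ => (hd t z).hasDerivAt)).2.differentiableAt
  have h := Complex.norm_deriv_le_of_forall_mem_sphere_norm_le (c := z) (C := C) one_pos
    (hd t).diffContOnCl fun y hy => hC (y, t) ⟨?_, uIoc_subset_uIcc ht⟩
  · simpa using h
  · have h1 : dist y z = 1 := hy
    have h2 : dist z z₀ < 1 := hz
    have := dist_triangle y z z₀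
    rw [Metric.mem_closedBall]
    linarith

theorem hasDerivAt_intervalIntegral_right {h : ℝ → ℂ} (hc : Continuous h) (x : ℝ) :
    HasDerivAt (fun x => ∫ t in (0 : ℝ)..x, h t) (h x) x :=
  intervalIntegral.integral_hasDerivAt_right (hc.intervalIntegrable _ _)
    (hc.stronglyMeasurableAtFilter _ _) hc.continuousAt

theorem continuous_conj_Λ₂ {μ : ℂ} (hμ : μ ≠ conj μ) (d : ℝ) (i : Fin 2) :
    Continuous fun x => conj (Λ₂ μ d x i) :=
  Complex.continuous_conj.comp (continuous_Λ₂_apply hμ d i)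

/-- The solution of `-u'' = z u + conj (Λ₂ 0)` with vanishing initial data. -/
noncomputable def psi (μ : ℂ) (d : ℝ) (z : ℂ) (x : ℝ) : ℂ :=
  cs z x * (∫ t in (0 : ℝ)..x, sn z t * conj (Λ₂ μ d t 0)) -
    sn z x * ∫ t in (0 : ℝ)..x, cs z t * conj (Λ₂ μ d t 0)

/-- The derivative of `psi`. -/
noncomputable def psi' (μ : ℂ) (d : ℝ) (z : ℂ) (x : ℝ) : ℂ :=
  -z * sn z x * (∫ t in (0 : ℝ)..x, sn z t * conj (Λ₂ μ d t 0)) -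
    cs z x * ∫ t in (0 : ℝ)..x, cs z t * conj (Λ₂ μ d t 0)

theorem hasDerivAt_psi {μ : ℂ} (hμ : μ ≠ conj μ) (d : ℝ) (z : ℂ) (x : ℝ) :
    HasDerivAt (psi μ d z) (psi' μ d z x) x := by
  have h1 := hasDerivAt_intervalIntegral_right
    ((continuous_sn_right z).mul (continuous_conj_Λ₂ hμ d 0)) x
  have h2 := hasDerivAt_intervalIntegral_right
    ((continuous_cs_right z).mul (continuous_conj_Λ₂ hμ d 0)) x
  refine (((hasDerivAt_cs z x).mul h1).sub ((hasDerivAt_sn z x).mul h2)).congr_deriv ?_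
  simp only [Pi.mul_apply]
  rw [psi']
  ring

theorem hasDerivAt_psi' {μ : ℂ} (hμ : μ ≠ conj μ) (d : ℝ) (z : ℂ) (x : ℝ) :
    HasDerivAt (psi' μ d z) (-z * psi μ d z x - conj (Λ₂ μ d x 0)) x := by
  have h1 := hasDerivAt_intervalIntegral_right
    ((continuous_sn_right z).mul (continuous_conj_Λ₂ hμ d 0)) x
  have h2 := hasDerivAt_intervalIntegral_right
    ((continuous_cs_right z).mul (continuous_conj_Λ₂ hμ d 0)) x
  refine ((((hasDerivAt_sn z x).const_mul (-z)).mul h1).sub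
    ((hasDerivAt_cs z x).mul h2)).congr_deriv ?_
  simp only [Pi.mul_apply]
  rw [psi]
  linear_combination (-conj (Λ₂ μ d x 0)) * cs_sq_add z x

@[simp] theorem psi_at_zero (μ : ℂ) (d : ℝ) (z : ℂ) : psi μ d z 0 = 0 := by simp [psi]

@[simp] theorem psi'_at_zero (μ : ℂ) (d : ℝ) (z : ℂ) : psi' μ d z 0 = 0 := by simp [psi']

/-- Joint continuity is what `differentiable_intervalIntegral` requires in order to show that `phiV`
is entire in `z`. -/
theorem continuous_psi {μ : ℂ} (hμ : μ ≠ conj μ) (d : ℝ) :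
    Continuous fun p : ℂ × ℝ => psi μ d p.1 p.2 := by
  have h0 := continuous_conj_Λ₂ hμ d 0
  have hs : Continuous fun p : ℂ × ℝ => ∫ t in (0 : ℝ)..p.2, sn p.1 t * conj (Λ₂ μ d t 0) := by
    refine intervalIntegral.continuous_parametric_intervalIntegral_of_continuous ?_ continuous_snd
    exact (continuous_sn.comp (by fun_prop : Continuous fun q : (ℂ × ℝ) × ℝ => (q.1.1, q.2))).mul
      (h0.comp continuous_snd)
  have hc : Continuous fun p : ℂ × ℝ => ∫ t in (0 : ℝ)..p.2, cs p.1 t * conj (Λ₂ μ d t 0) := by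
    refine intervalIntegral.continuous_parametric_intervalIntegral_of_continuous ?_ continuous_snd
    exact (continuous_cs.comp (by fun_prop : Continuous fun q : (ℂ × ℝ) × ℝ => (q.1.1, q.2))).mul
      (h0.comp continuous_snd)
  exact (continuous_cs.mul hs).sub (continuous_sn.mul hc)

theorem differentiable_psi_aux {μ : ℂ} (hμ : μ ≠ conj μ) (d : ℝ) (x : ℝ) :
    (Differentiable ℂ fun z => ∫ t in (0 : ℝ)..x, sn z t * conj (Λ₂ μ d t 0)) ∧
    Differentiable ℂ fun z => ∫ t in (0 : ℝ)..x, cs z t * conj (Λ₂ μ d t 0) := by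
  have h0 := continuous_conj_Λ₂ hμ d 0
  exact ⟨differentiable_intervalIntegral (continuous_sn.mul (h0.comp continuous_snd))
    (fun t => (differentiable_sn t).mul_const _) _ _,
    differentiable_intervalIntegral (continuous_cs.mul (h0.comp continuous_snd))
    (fun t => (differentiable_cs t).mul_const _) _ _⟩

theorem differentiable_psi {μ : ℂ} (hμ : μ ≠ conj μ) (d : ℝ) (x : ℝ) :
    Differentiable ℂ fun z => psi μ d z x :=
  ((differentiable_cs x).mul (differentiable_psi_aux hμ d x).1).sub
    ((differentiable_sn x).mul (differentiable_psi_aux hμ d x).2)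

theorem differentiable_psi' {μ : ℂ} (hμ : μ ≠ conj μ) (d : ℝ) (x : ℝ) :
    Differentiable ℂ fun z => psi' μ d z x :=
  ((differentiable_id.neg.mul (differentiable_sn x)).mul (differentiable_psi_aux hμ d x).1).sub
    ((differentiable_cs x).mul (differentiable_psi_aux hμ d x).2)

/-- `psi` is the second divided difference in `z` of `cs - d sn` at the point `conj μ`. -/
theorem cs_sub_eq {μ : ℂ} (hμ : μ ≠ conj μ) (d : ℝ) (z : ℂ) (x : ℝ) :
    cs z x - d * sn z x =
    (z - conj μ) * conj (Λ₂ μ d x 0) + conj (Λ₂ μ d x 1) + (z - conj μ) ^ 2 * psi μ d z x := by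
  have h2 := fun y i => hasDerivAt_conj_comp (hasDerivAt_Λ₂_apply hμ d y i)
  have h10 := fun y => hasDerivAt_conj_comp (hasDerivAt_Λ₁_zero hμ d y)
  have h11 := fun y => hasDerivAt_conj_comp (hasDerivAt_Λ₁_one hμ d y)
  -- With `p = (z - μ̄) conj (Λ₂ 0) + conj (Λ₂ 1)` one has `p'' + z p = (z - μ̄)² conj (Λ₂ 0)`,
  -- which the source term of `psi` cancels. So the difference of the two sides solves the free
  -- equation, and its initial data vanish.
  have h := eq_zero_of_hasDerivAt (z := z)
    (u := fun x => cs z x - d * sn z x - ((z - conj μ) * conj (Λ₂ μ d x 0) +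
      conj (Λ₂ μ d x 1) + (z - conj μ) ^ 2 * psi μ d z x))
    (u' := fun x => -z * sn z x - d * cs z x + ((z - conj μ) * conj (Λ₁ μ d x 0) +
      conj (Λ₁ μ d x 1) - (z - conj μ) ^ 2 * psi' μ d z x)) (fun y => ?_) (fun y => ?_) ?_ ?_ x
  · exact sub_eq_zero.1 h
  · refine (((hasDerivAt_cs z y).sub ((hasDerivAt_sn z y).const_mul (d : ℂ))).sub
      ((((h2 y 0).const_mul _).add (h2 y 1)).add
      ((hasDerivAt_psi hμ d z y).const_mul _))).congr_deriv ?_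
    simp only [map_neg]
    ring
  · refine ((((hasDerivAt_sn z y).const_mul (-z)).sub
      ((hasDerivAt_cs z y).const_mul (d : ℂ))).add
      ((((h10 y).const_mul _).add (h11 y)).sub
      ((hasDerivAt_psi' hμ d z y).const_mul _))).congr_deriv ?_
    simp only [map_add, map_mul]
    ring
  · simp [Λ₂_at_zero]
  · simp [Λ₁_at_zero hμ]

/-! ### The transformation of solutions -/

theorem isSolution_of_hasDerivAt {q : ℝ → ℂ} {z : ℂ} {y y₁ y₂ : ℝ → ℂ}
    (h1 : ∀ x, 0 < x → HasDerivAt y (y₁ x) x) (h2 : ∀ x, 0 < x → HasDerivAt y₁ (y₂ x) x)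
    (h : ∀ x, 0 < x → -y₂ x + q x * y x = z * y x) : IsSolution q z y := fun x hx => by
  have e : deriv y =ᶠ[𝓝 x] y₁ := by
    filter_upwards [Ioi_mem_nhds hx] with t ht using (h1 t ht).deriv
  have h3 := (h2 x hx).congr_of_eventuallyEq e
  exact ⟨(h1 x hx).differentiableAt, h3.differentiableAt, by rw [h3.deriv, h x hx]⟩

theorem hasDerivAt_star_dotProduct {a b : ℝ → Fin 2 → ℂ} {a' b' : Fin 2 → ℂ} {x : ℝ}
    (ha : HasDerivAt a a' x) (hb : HasDerivAt b b' x) :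
    HasDerivAt (fun x => star (a x) ⬝ᵥ b x) (star a' ⬝ᵥ b x + star (a x) ⬝ᵥ b') x := by
  simp only [dotProduct, Fin.sum_univ_two, Pi.star_apply]
  have h := fun i => (hasDerivAt_conj_comp (hasDerivAt_pi.1 ha i)).mul (hasDerivAt_pi.1 hb i)
  refine ((h 0).add (h 1)).congr_deriv ?_
  simp only [Complex.star_def]
  ring

theorem hasDerivAt_inv_S_mulVec {μ : ℂ} (hμ : μ ≠ conj μ) (d : ℝ) {x : ℝ} (hx : 0 < x)
    {v : ℝ → Fin 2 → ℂ} {v' : Fin 2 → ℂ} (hv : HasDerivAt v v' x) :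
    HasDerivAt (fun x => (S μ d x)⁻¹ *ᵥ v x)
      ((S μ d x)⁻¹ *ᵥ v' - (star (Λ₂ μ d x) ⬝ᵥ ((S μ d x)⁻¹ *ᵥ v x)) •
        ((S μ d x)⁻¹ *ᵥ Λ₂ μ d x)) x := by
  have hP := fun i j => hasDerivAt_inv_S_apply hμ d hx i j
  have hv' := hasDerivAt_pi.1 hv
  refine hasDerivAt_pi.2 fun i => ?_
  have h := ((hP i 0).mul (hv' 0)).add ((hP i 1).mul (hv' 1))
  have e : (fun x => ((S μ d x)⁻¹ *ᵥ v x) i) = fun x => (S μ d x)⁻¹ i 0 * v x 0 +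
      (S μ d x)⁻¹ i 1 * v x 1 := by
    ext y; simp only [Matrix.mulVec, dotProduct, Fin.sum_univ_two]
  rw [e]
  refine h.congr_deriv ?_
  simp only [Matrix.mulVec, Matrix.vecMul, dotProduct, Fin.sum_univ_two, Pi.sub_apply,
    Pi.smul_apply, smul_eq_mul]
  ring

/-- The function `Λ₂* S⁻¹ Λ₂`. -/
noncomputable def gramQuotient (μ : ℂ) (d x : ℝ) : ℂ :=
  star (Λ₂ μ d x) ⬝ᵥ ((S μ d x)⁻¹ *ᵥ Λ₂ μ d x)

/-- The transform `u + Λ₂* S⁻¹ v` of the pair `u`, `v`. -/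
noncomputable def transform (μ : ℂ) (d : ℝ) (u : ℝ → ℂ) (v : ℝ → Fin 2 → ℂ) (x : ℝ) : ℂ :=
  u x + star (Λ₂ μ d x) ⬝ᵥ ((S μ d x)⁻¹ *ᵥ v x)

/-- The derivative of the transform of a pair `u`, `v` with `v' = -u Λ₂`, where `u₁ = u'`. -/
noncomputable def transformDeriv (μ : ℂ) (d : ℝ) (u u₁ : ℝ → ℂ) (v : ℝ → Fin 2 → ℂ) (x : ℝ) : ℂ :=
  u₁ x - star (Λ₁ μ d x) ⬝ᵥ ((S μ d x)⁻¹ *ᵥ v x) - gramQuotient μ d x * transform μ d u v x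

/-- The contribution `-u` of `v'` and the contribution `-Λ₂* S⁻¹ v` of `(S⁻¹)'` multiply the same
vector `S⁻¹ Λ₂` and add up to minus the transform. -/
theorem hasDerivAt_inv_S_mulVec_pair {μ : ℂ} (hμ : μ ≠ conj μ) (d : ℝ) {x : ℝ} (hx : 0 < x)
    {u : ℝ → ℂ} {v : ℝ → Fin 2 → ℂ} (hv : HasDerivAt v (-(u x • Λ₂ μ d x)) x) :
    HasDerivAt (fun x => (S μ d x)⁻¹ *ᵥ v x)
      (-(transform μ d u v x • ((S μ d x)⁻¹ *ᵥ Λ₂ μ d x))) x := by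
  refine (hasDerivAt_inv_S_mulVec hμ d hx hv).congr_deriv ?_
  rw [transform, Matrix.mulVec_neg, Matrix.mulVec_smul]
  module

theorem hasDerivAt_transform {μ : ℂ} (hμ : μ ≠ conj μ) (d : ℝ) {x : ℝ} (hx : 0 < x)
    {u u₁ : ℝ → ℂ} {v : ℝ → Fin 2 → ℂ} (hu : HasDerivAt u (u₁ x) x)
    (hv : HasDerivAt v (-(u x • Λ₂ μ d x)) x) :
    HasDerivAt (transform μ d u v) (transformDeriv μ d u u₁ v x) x := by
  refine (hu.add (hasDerivAt_star_dotProduct (hasDerivAt_Λ₂ hμ d x)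
    (hasDerivAt_inv_S_mulVec_pair hμ d hx hv))).congr_deriv ?_
  simp only [transformDeriv, gramQuotient, star_neg, neg_dotProduct, dotProduct_neg,
    dotProduct_smul, smul_eq_mul]
  ring

/-- Comparison with `transformedPotential` gives `q̃ = -2 (Λ₂* S⁻¹ Λ₂)'`, the familiar form of a
Darboux-transformed potential. -/
theorem hasDerivAt_gramQuotient {μ : ℂ} (hμ : μ ≠ conj μ) (d : ℝ) {x : ℝ} (hx : 0 < x) :
    HasDerivAt (gramQuotient μ d) (-(star (Λ₁ μ d x) ⬝ᵥ ((S μ d x)⁻¹ *ᵥ Λ₂ μ d x)) -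
      star (Λ₂ μ d x) ⬝ᵥ ((S μ d x)⁻¹ *ᵥ Λ₁ μ d x) - gramQuotient μ d x ^ 2) x := by
  refine (hasDerivAt_star_dotProduct (hasDerivAt_Λ₂ hμ d x)
    (hasDerivAt_inv_S_mulVec hμ d hx (hasDerivAt_Λ₂ hμ d x))).congr_deriv ?_
  simp only [gramQuotient, star_neg, neg_dotProduct, dotProduct_sub, Matrix.mulVec_neg,
    dotProduct_neg, dotProduct_smul, smul_eq_mul]
  ring

theorem lyapunov_mulVec {μ : ℂ} (hμ : μ ≠ conj μ) (d x : ℝ) (p : Fin 2 → ℂ) :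
    A μ *ᵥ (S μ d x *ᵥ p) - S μ d x *ᵥ ((A μ)ᴴ *ᵥ p) =
      (star (Λ₂ μ d x) ⬝ᵥ p) • Λ₁ μ d x - (star (Λ₁ μ d x) ⬝ᵥ p) • Λ₂ μ d x := by
  rw [Matrix.mulVec_mulVec, Matrix.mulVec_mulVec, ← Matrix.sub_mulVec, lyapunov_identity hμ]
  ext i
  simp only [Matrix.mulVec, Matrix.vecMulVec_apply, Matrix.sub_apply, dotProduct,
    Fin.sum_univ_two, Pi.sub_apply, Pi.smul_apply, smul_eq_mul]
  ring

/-- The transformation maps solutions of `-u'' = z u + Λ₂* k` to solutions for `q̃`. -/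
theorem isSolution_transform {μ : ℂ} (hμ : μ ≠ conj μ) (d : ℝ) {z : ℂ} {u u₁ : ℝ → ℂ}
    {v : ℝ → Fin 2 → ℂ} {k : Fin 2 → ℂ} (hu : ∀ x, HasDerivAt u (u₁ x) x)
    (hu₁ : ∀ x, HasDerivAt u₁ (-z * u x - star (Λ₂ μ d x) ⬝ᵥ k) x)
    (hv : ∀ x, HasDerivAt v (-(u x • Λ₂ μ d x)) x)
    (huv : ∀ x, z • v x - A μ *ᵥ v x = u x • Λ₁ μ d x + u₁ x • Λ₂ μ d x + S μ d x *ᵥ k) :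
    IsSolution (qTilde μ d) z (transform μ d u v) := by
  refine isSolution_of_hasDerivAt (fun x hx => hasDerivAt_transform hμ d hx (hu x) (hv x))
    (fun x hx => ((hu₁ x).sub (hasDerivAt_star_dotProduct (hasDerivAt_Λ₁ hμ d x)
      (hasDerivAt_inv_S_mulVec_pair hμ d hx (hv x)))).sub
      ((hasDerivAt_gramQuotient hμ d hx).mul
        (hasDerivAt_transform hμ d hx (hu x) (hv x)))) fun x hx => ?_
  set L₁ := Λ₁ μ d x
  set L₂ := Λ₂ μ d x
  set P := (S μ d x)⁻¹ with hP
  set p := P *ᵥ v x with hp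
  have hPS : ∀ m, P *ᵥ (S μ d x *ᵥ m) = m := fun m => by
    rw [Matrix.mulVec_mulVec, hP, inv_S_mul hμ d hx, Matrix.one_mulVec]
  have hSp : S μ d x *ᵥ p = v x := by
    rw [hp, Matrix.mulVec_mulVec, hP, S_mul_inv hμ d hx, Matrix.one_mulVec]
  -- The Lyapunov identity applied to `p = S⁻¹ v` moves `A` across `S⁻¹`.
  have hA : star L₂ ⬝ᵥ (P *ᵥ (A μ *ᵥ v x)) - star (A μ *ᵥ L₂) ⬝ᵥ p =
      (star L₂ ⬝ᵥ p) * (star L₂ ⬝ᵥ (P *ᵥ L₁)) - (star L₁ ⬝ᵥ p) * (star L₂ ⬝ᵥ (P *ᵥ L₂)) := by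
    have h := congrArg (fun m => star L₂ ⬝ᵥ (P *ᵥ m)) (lyapunov_mulVec hμ d x p)
    simp only [Matrix.mulVec_sub, dotProduct_sub, Matrix.mulVec_smul, dotProduct_smul,
      smul_eq_mul] at h
    rw [hSp, hPS] at h
    rw [Matrix.star_mulVec, ← Matrix.dotProduct_mulVec]
    exact h
  -- Here `S k` turns into `Λ₂* k`, which compensates the source term in `hu₁`.
  have hB := congrArg (fun m => star L₂ ⬝ᵥ (P *ᵥ m)) (huv x)
  simp only [Matrix.mulVec_sub, Matrix.mulVec_add, dotProduct_sub, dotProduct_add,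
    Matrix.mulVec_smul, dotProduct_smul, smul_eq_mul] at hB
  rw [hPS, ← hp] at hB
  simp only [qTilde, transformedPotential, transformDeriv, gramQuotient, transform,
    dotProduct_neg, dotProduct_smul, smul_eq_mul]
  linear_combination -hB - hA

/-! ### The solutions -/

/-- The vector function belonging to `-(z - μ)² sn`. -/
noncomputable def thetaV (μ : ℂ) (d : ℝ) (z : ℂ) (x : ℝ) : Fin 2 → ℂ :=
  ![-((z - μ) * (sn z x * Λ₁ μ d x 0 + cs z x * Λ₂ μ d x 0) +
      (sn z x * Λ₁ μ d x 1 + cs z x * Λ₂ μ d x 1)),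
    -((z - μ) * (sn z x * Λ₁ μ d x 1 + cs z x * Λ₂ μ d x 1))]

/-- The vector function belonging to `psi`. -/
noncomputable def phiV (μ : ℂ) (d : ℝ) (z : ℂ) (x : ℝ) : Fin 2 → ℂ :=
  fun i => -∫ t in (0 : ℝ)..x, Λ₂ μ d t i * psi μ d z t

/-- The solution `θ̃`. -/
noncomputable def theta (μ : ℂ) (d : ℝ) (z : ℂ) : ℝ → ℂ :=
  transform μ d (fun x => -(z - μ) ^ 2 * sn z x) (thetaV μ d z)

/-- The derivative of `theta`. -/
noncomputable def thetaDeriv (μ : ℂ) (d : ℝ) (z : ℂ) : ℝ → ℂ :=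
  transformDeriv μ d (fun x => -(z - μ) ^ 2 * sn z x) (fun x => -(z - μ) ^ 2 * cs z x)
    (thetaV μ d z)

/-- The solution `φ̃`. -/
noncomputable def phi (μ : ℂ) (d : ℝ) (z : ℂ) : ℝ → ℂ :=
  transform μ d (psi μ d z) (phiV μ d z)

/-- The derivative of `phi`. -/
noncomputable def phiDeriv (μ : ℂ) (d : ℝ) (z : ℂ) : ℝ → ℂ :=
  transformDeriv μ d (psi μ d z) (psi' μ d z) (phiV μ d z)

theorem hasDerivAt_thetaV {μ : ℂ} (hμ : μ ≠ conj μ) (d : ℝ) (z : ℂ) (x : ℝ) :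
    HasDerivAt (thetaV μ d z) (-((-(z - μ) ^ 2 * sn z x) • Λ₂ μ d x)) x := by
  have h2 := fun i => hasDerivAt_Λ₂_apply hμ d x i
  have h10 := hasDerivAt_Λ₁_zero hμ d x
  have h11 := hasDerivAt_Λ₁_one hμ d x
  have hs := hasDerivAt_sn z x
  have hc := hasDerivAt_cs z x
  apply hasDerivAt_fin_two
  · refine ((((hs.mul h10).add (hc.mul (h2 0))).const_mul (z - μ)).add
      ((hs.mul h11).add (hc.mul (h2 1)))).neg.congr_deriv ?_
    simp only [Pi.neg_apply, Pi.smul_apply, smul_eq_mul]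
    ring
  · refine (((hs.mul h11).add (hc.mul (h2 1))).const_mul (z - μ)).neg.congr_deriv ?_
    simp only [Pi.neg_apply, Pi.smul_apply, smul_eq_mul]
    ring

/-- For the Jordan block, `(z - μ)² (z - A)⁻¹ = (z - μ) I + N` with `N` the nilpotent part, so the
factor `(z - μ)²` makes the vector function polynomial in `z - μ`, `cs` and `sn`, and no condition
`z ≠ μ` is needed. -/
theorem thetaV_eq (μ : ℂ) (d : ℝ) (z : ℂ) (x : ℝ) :
    z • thetaV μ d z x - A μ *ᵥ thetaV μ d z x =
      (-(z - μ) ^ 2 * sn z x) • Λ₁ μ d x + (-(z - μ) ^ 2 * cs z x) • Λ₂ μ d x := by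
  rw [A_mulVec]
  ext i
  fin_cases i <;> simp [thetaV] <;> ring

theorem continuous_psi_right {μ : ℂ} (hμ : μ ≠ conj μ) (d : ℝ) (z : ℂ) :
    Continuous (psi μ d z) :=
  continuous_iff_continuousAt.2 fun x => (hasDerivAt_psi hμ d z x).continuousAt

theorem hasDerivAt_phiV {μ : ℂ} (hμ : μ ≠ conj μ) (d : ℝ) (z : ℂ) (x : ℝ) :
    HasDerivAt (phiV μ d z) (-(psi μ d z x • Λ₂ μ d x)) x := by
  refine hasDerivAt_pi.2 fun i => ?_
  refine (hasDerivAt_intervalIntegral_right ((continuous_Λ₂_apply hμ d i).mul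
    (continuous_psi_right hμ d z)) x).neg.congr_deriv ?_
  simp [mul_comm]

@[simp] theorem phiV_at_zero (μ : ℂ) (d : ℝ) (z : ℂ) (i : Fin 2) : phiV μ d z 0 i = 0 := by
  simp [phiV]

/-- Both sides vanish at `0` and have derivative `-psi (z - A) Λ₂`: the derivative of the first
column of `S` cancels the source term `-conj (Λ₂ 0)` of `psi''`. This is the case `k = ![1, 0]` of
`isSolution_transform`. -/
theorem phiV_eq {μ : ℂ} (hμ : μ ≠ conj μ) (d : ℝ) (z : ℂ) (x : ℝ) :
    z • phiV μ d z x - A μ *ᵥ phiV μ d z x =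
      psi μ d z x • Λ₁ μ d x + psi' μ d z x • Λ₂ μ d x + S μ d x *ᵥ ![1, 0] := by
  have h2 := fun y i => hasDerivAt_Λ₂_apply hμ d y i
  have h10 := fun y => hasDerivAt_Λ₁_zero hμ d y
  have h11 := fun y => hasDerivAt_Λ₁_one hμ d y
  have hp := fun y => hasDerivAt_psi hμ d z y
  have hp' := fun y => hasDerivAt_psi' hμ d z y
  have hS := fun y i => hasDerivAt_S_apply hμ d y i 0
  have hv := fun y i => hasDerivAt_pi.1 (hasDerivAt_phiV hμ d z y) i
  have hSe : ∀ i, (S μ d x *ᵥ ![1, 0]) i = S μ d x i 0 := fun i => by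
    simp [Matrix.mulVec, dotProduct, Fin.sum_univ_two]
  rw [A_mulVec]
  ext i
  rw [Pi.add_apply, hSe]
  fin_cases i
  · refine eq_of_hasDerivAt_eq (f := fun x => z * phiV μ d z x 0 - (μ * phiV μ d z x 0 +
      phiV μ d z x 1)) (fun y => (((hv y 0).const_mul z).sub
      (((hv y 0).const_mul μ).add (hv y 1)))) (fun y => ((((hp y).mul (h10 y)).add
      ((hp' y).mul (h2 y 0))).add (hS y 0)).congr_deriv ?_) (by simp [S_at_zero]) x
    simp only [Pi.neg_apply, Pi.smul_apply, smul_eq_mul]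
    ring
  · refine eq_of_hasDerivAt_eq (f := fun x => z * phiV μ d z x 1 - μ * phiV μ d z x 1)
      (fun y => (((hv y 1).const_mul z).sub
      ((hv y 1).const_mul μ))) (fun y => ((((hp y).mul (h11 y)).add
      ((hp' y).mul (h2 y 1))).add (hS y 1)).congr_deriv ?_) (by simp [S_at_zero]) x
    simp only [Pi.neg_apply, Pi.smul_apply, smul_eq_mul]
    ring

theorem isSolution_theta {μ : ℂ} (hμ : μ ≠ conj μ) (d : ℝ) (z : ℂ) :
    IsSolution (qTilde μ d) z (theta μ d z) := by
  refine isSolution_transform (u₁ := fun x => -(z - μ) ^ 2 * cs z x) (k := 0) hμ d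
    (fun x => (hasDerivAt_sn z x).const_mul _)
    (fun x => ((hasDerivAt_cs z x).const_mul _).congr_deriv ?_) (hasDerivAt_thetaV hμ d z)
    fun x => ?_
  · rw [dotProduct_zero]; ring
  · rw [thetaV_eq, Matrix.mulVec_zero, add_zero]

theorem isSolution_phi {μ : ℂ} (hμ : μ ≠ conj μ) (d : ℝ) (z : ℂ) :
    IsSolution (qTilde μ d) z (phi μ d z) := by
  refine isSolution_transform (u₁ := psi' μ d z) (k := ![1, 0]) hμ d
    (hasDerivAt_psi hμ d z) (fun x => (hasDerivAt_psi' hμ d z x).congr_deriv ?_)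
    (hasDerivAt_phiV hμ d z) (phiV_eq hμ d z)
  simp [dotProduct, Fin.sum_univ_two]

theorem hasDerivAt_theta {μ : ℂ} (hμ : μ ≠ conj μ) (d : ℝ) (z : ℂ) {x : ℝ} (hx : 0 < x) :
    HasDerivAt (theta μ d z) (thetaDeriv μ d z x) x :=
  hasDerivAt_transform (u₁ := fun x => -(z - μ) ^ 2 * cs z x) hμ d hx
    ((hasDerivAt_sn z x).const_mul _) (hasDerivAt_thetaV hμ d z x)

theorem hasDerivAt_phi {μ : ℂ} (hμ : μ ≠ conj μ) (d : ℝ) (z : ℂ) {x : ℝ} (hx : 0 < x) :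
    HasDerivAt (phi μ d z) (phiDeriv μ d z x) x :=
  hasDerivAt_transform hμ d hx (hasDerivAt_psi hμ d z x) (hasDerivAt_phiV hμ d z x)

theorem differentiable_transform (μ : ℂ) (d x : ℝ) {u : ℂ → ℝ → ℂ} {v : ℂ → ℝ → Fin 2 → ℂ}
    (hu : Differentiable ℂ fun z => u z x) (hv : ∀ i, Differentiable ℂ fun z => v z x i) :
    Differentiable ℂ fun z => transform μ d (u z) (v z) x := by
  simp only [transform, Matrix.mulVec, dotProduct, Fin.sum_univ_two]
  have h0 := hv 0
  have h1 := hv 1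
  fun_prop

theorem differentiable_transformDeriv (μ : ℂ) (d x : ℝ) {u u₁ : ℂ → ℝ → ℂ}
    {v : ℂ → ℝ → Fin 2 → ℂ}
    (hu : Differentiable ℂ fun z => u z x) (hu₁ : Differentiable ℂ fun z => u₁ z x)
    (hv : ∀ i, Differentiable ℂ fun z => v z x i) :
    Differentiable ℂ fun z => transformDeriv μ d (u z) (u₁ z) (v z) x := by
  have h := differentiable_transform μ d x hu hv
  simp only [transformDeriv, Matrix.mulVec, dotProduct, Fin.sum_univ_two]
  have h0 := hv 0
  have h1 := hv 1
  fun_prop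

theorem differentiable_thetaV (μ : ℂ) (d x : ℝ) (i : Fin 2) :
    Differentiable ℂ fun z => thetaV μ d z x i := by
  have hs := differentiable_sn x
  have hc := differentiable_cs x
  fin_cases i
  · change Differentiable ℂ fun z => -((z - μ) * (sn z x * Λ₁ μ d x 0 + cs z x * Λ₂ μ d x 0) +
      (sn z x * Λ₁ μ d x 1 + cs z x * Λ₂ μ d x 1))
    fun_prop
  · change Differentiable ℂ fun z => -((z - μ) * (sn z x * Λ₁ μ d x 1 + cs z x * Λ₂ μ d x 1))
    fun_prop

theorem differentiable_phiV {μ : ℂ} (hμ : μ ≠ conj μ) (d x : ℝ) (i : Fin 2) :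
    Differentiable ℂ fun z => phiV μ d z x i :=
  (differentiable_intervalIntegral
    (((continuous_Λ₂_apply hμ d i).comp continuous_snd).mul (continuous_psi hμ d))
    (fun t => (differentiable_psi hμ d t).const_mul _) _ _).neg

theorem differentiable_theta (μ : ℂ) (d x : ℝ) : Differentiable ℂ fun z => theta μ d z x := by
  refine differentiable_transform μ d x ?_ (differentiable_thetaV μ d x)
  have hs := differentiable_sn x
  fun_prop

theorem differentiable_thetaDeriv (μ : ℂ) (d x : ℝ) :
    Differentiable ℂ fun z => thetaDeriv μ d z x := by
  have hs := differentiable_sn x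
  have hc := differentiable_cs x
  refine differentiable_transformDeriv μ d x ?_ ?_ (differentiable_thetaV μ d x)
  · fun_prop
  · fun_prop

theorem differentiable_phi {μ : ℂ} (hμ : μ ≠ conj μ) (d x : ℝ) :
    Differentiable ℂ fun z => phi μ d z x :=
  differentiable_transform μ d x (differentiable_psi hμ d x) (differentiable_phiV hμ d x)

theorem differentiable_phiDeriv {μ : ℂ} (hμ : μ ≠ conj μ) (d x : ℝ) :
    Differentiable ℂ fun z => phiDeriv μ d z x :=
  differentiable_transformDeriv μ d x (differentiable_psi hμ d x) (differentiable_psi' hμ d x)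
    (differentiable_phiV hμ d x)

/-! ### The Darboux matrix -/

theorem det_sub_A (μ z : ℂ) : (z • (1 : Matrix (Fin 2) (Fin 2) ℂ) - A μ).det = (z - μ) ^ 2 := by
  simp [A, Matrix.det_fin_two]; ring

theorem det_sub_A_conjTranspose (μ z : ℂ) :
    (z • (1 : Matrix (Fin 2) (Fin 2) ℂ) - (A μ)ᴴ).det = (z - conj μ) ^ 2 := by
  simp [A, Matrix.det_fin_two, Matrix.conjTranspose_apply]; ring

theorem isUnit_det_sub_A {μ z : ℂ} (hz : z ≠ μ) :
    IsUnit (z • (1 : Matrix (Fin 2) (Fin 2) ℂ) - A μ).det := by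
  rw [det_sub_A, isUnit_iff_ne_zero]
  exact pow_ne_zero _ (sub_ne_zero.2 hz)

theorem J_mul_conjTranspose_mulVec (μ : ℂ) (d x : ℝ) (m : Fin 2 → ℂ) :
    (J * (Λ μ d x)ᴴ) *ᵥ m = ![star (Λ₂ μ d x) ⬝ᵥ m, -(star (Λ₁ μ d x) ⬝ᵥ m)] := by
  rw [← Matrix.mulVec_mulVec]
  ext i
  fin_cases i <;>
    simp [Λ, J, Matrix.mulVec, dotProduct, Fin.sum_univ_two]

/-- Here `v` is `(z - A)⁻¹ Λ ξ`, characterized without the inverse. The first component is the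
transform; for `ξ = (u, u')` the second one is its derivative plus `gramQuotient` times the
transform, so Wronskians become determinants. -/
theorem darbouxMatrix_mulVec {μ z : ℂ} (hz : z ≠ μ) (d x : ℝ) {v ξ : Fin 2 → ℂ}
    (hv : z • v - A μ *ᵥ v = ξ 0 • Λ₁ μ d x + ξ 1 • Λ₂ μ d x) :
    darbouxMatrix (A μ) (S μ d x) (Λ μ d x) z *ᵥ ξ =
      ![ξ 0 + star (Λ₂ μ d x) ⬝ᵥ ((S μ d x)⁻¹ *ᵥ v),
        ξ 1 - star (Λ₁ μ d x) ⬝ᵥ ((S μ d x)⁻¹ *ᵥ v)] := by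
  have hΛ : Λ μ d x *ᵥ ξ = (z • (1 : Matrix (Fin 2) (Fin 2) ℂ) - A μ) *ᵥ v := by
    rw [Matrix.sub_mulVec, Matrix.smul_mulVec, Matrix.one_mulVec, hv]
    ext i
    simp [Λ, Matrix.mulVec, dotProduct, Fin.sum_univ_two, mul_comm]
  rw [darbouxMatrix, Matrix.add_mulVec, Matrix.one_mulVec, ← Matrix.mulVec_mulVec, hΛ,
    Matrix.mulVec_mulVec, Matrix.mul_assoc, Matrix.nonsing_inv_mul _ (isUnit_det_sub_A hz),
    Matrix.mul_one, ← Matrix.mulVec_mulVec, J_mul_conjTranspose_mulVec]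
  ext i
  fin_cases i
  · rfl
  · exact (sub_eq_add_neg _ _).symm

theorem yTilde_dotProduct (μ : ℂ) (d : ℝ) (z : ℂ) (x : ℝ) (b : Fin 2 → ℂ) :
    yTilde μ d z x ⬝ᵥ b =
      (darbouxMatrix (A μ) (S μ d x) (Λ μ d x) z *ᵥ (w z x *ᵥ b)) 0 := by
  rw [yTilde, ← Matrix.dotProduct_mulVec, Matrix.mulVec_mulVec]
  simp [dotProduct, Fin.sum_univ_two]

theorem w_mulVec_zero_one (z : ℂ) (x : ℝ) : w z x *ᵥ ![0, 1] = ![sn z x, cs z x] := by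
  rw [w_eq]
  ext i
  fin_cases i <;> simp [Matrix.mulVec, dotProduct, Fin.sum_univ_two]

theorem w_mulVec_one_neg (z : ℂ) (d x : ℝ) : w z x *ᵥ ![1, -(d : ℂ)] =
    ![cs z x - d * sn z x, -z * sn z x - d * cs z x] := by
  rw [w_eq]
  ext i
  fin_cases i <;> simp [Matrix.mulVec, dotProduct, Fin.sum_univ_two] <;> ring

theorem darbouxMatrix_mulVec_theta {μ z : ℂ} (hz : z ≠ μ) (d x : ℝ) :
    (-(z - μ) ^ 2) • (darbouxMatrix (A μ) (S μ d x) (Λ μ d x) z *ᵥ (w z x *ᵥ ![0, 1])) =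
      ![theta μ d z x, thetaDeriv μ d z x + gramQuotient μ d x * theta μ d z x] := by
  rw [← Matrix.mulVec_smul, w_mulVec_zero_one, darbouxMatrix_mulVec hz d x (v := thetaV μ d z x)]
  · ext i
    fin_cases i
    · simp [theta, transform]
    · simp [theta, thetaDeriv, transformDeriv]
  · rw [thetaV_eq]
    simp

theorem cs_sub_deriv_eq {μ : ℂ} (hμ : μ ≠ conj μ) (d : ℝ) (z : ℂ) (x : ℝ) :
    -z * sn z x - d * cs z x = -((z - conj μ) * conj (Λ₁ μ d x 0) + conj (Λ₁ μ d x 1)) +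
      (z - conj μ) ^ 2 * psi' μ d z x := by
  have h2 := fun i => hasDerivAt_conj_comp (hasDerivAt_Λ₂_apply hμ d x i)
  have h := (((h2 0).const_mul (z - conj μ)).add (h2 1)).add
      ((hasDerivAt_psi hμ d z x).const_mul ((z - conj μ) ^ 2))
  have h' := (hasDerivAt_cs z x).sub ((hasDerivAt_sn z x).const_mul (d : ℂ))
  rw [show (cs z - fun y => (d : ℂ) * sn z y) = _ from funext (cs_sub_eq hμ d z)] at h'
  rw [h'.unique h]
  simp only [map_neg]
  ring

/-- Put `η = (z - μ̄, 1)`. The Taylor polynomial `Λ₂* η` is paired with `-S η`, and its transform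
`Λ₂* η - Λ₂* S⁻¹ S η` is zero. Only `(z - μ̄)²` times the transform of `psi` survives. -/
theorem darbouxMatrix_mulVec_phi {μ z : ℂ} (hμ : μ ≠ conj μ) (hz : z ≠ μ) (d : ℝ) {x : ℝ}
    (hx : 0 < x) :
    darbouxMatrix (A μ) (S μ d x) (Λ μ d x) z *ᵥ (w z x *ᵥ ![1, -(d : ℂ)]) =
      (z - conj μ) ^ 2 •
        ![phi μ d z x, phiDeriv μ d z x + gramQuotient μ d x * phi μ d z x] := by
  have hPS : ∀ m, (S μ d x)⁻¹ *ᵥ (S μ d x *ᵥ m) = m := fun m => by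
    rw [Matrix.mulVec_mulVec, inv_S_mul hμ d hx, Matrix.one_mulVec]
  rw [w_mulVec_one_neg, darbouxMatrix_mulVec hz d x
    (v := (z - conj μ) ^ 2 • phiV μ d z x - S μ d x *ᵥ ![z - conj μ, 1])]
  · rw [Matrix.mulVec_sub, hPS, Matrix.mulVec_smul]
    simp only [dotProduct_sub, dotProduct_smul, Matrix.cons_val_zero, Matrix.cons_val_one]
    have hd : ∀ L : Fin 2 → ℂ, star L ⬝ᵥ ![z - conj μ, 1] =
        conj (L 0) * (z - conj μ) + conj (L 1) := fun L => by
      simp [dotProduct, Fin.sum_univ_two]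
    rw [hd, hd, cs_sub_eq hμ, cs_sub_deriv_eq hμ]
    ext i
    fin_cases i
    · simp only [phi, transform, Pi.smul_apply, smul_eq_mul, Fin.zero_eta, Matrix.cons_val_zero]
      ring
    · simp only [phi, phiDeriv, transformDeriv, Pi.smul_apply, smul_eq_mul, Fin.mk_one,
        Matrix.cons_val_one, Matrix.cons_val_fin_one]
      ring
  · have h1 := phiV_eq hμ d z x
    have h2 := lyapunov_mulVec hμ d x ![z - conj μ, 1]
    -- An eigenvector relation for `A*` up to `(z - μ̄)²`; the defect produces the term `S ![1, 0]`
    -- that `phiV_eq` cancels.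
    have h3 : (A μ)ᴴ *ᵥ ![z - conj μ, 1] = z • ![z - conj μ, 1] - (z - conj μ) ^ 2 • ![1, 0] := by
      ext i
      fin_cases i <;>
        simp [A, Matrix.mulVec, dotProduct, Fin.sum_univ_two, Matrix.conjTranspose_apply]
      ring
    have h4 : star (Λ₂ μ d x) ⬝ᵥ ![z - conj μ, 1] + (z - conj μ) ^ 2 * psi μ d z x =
        cs z x - d * sn z x := by
      rw [cs_sub_eq hμ]; simp [dotProduct, Fin.sum_univ_two]; ring
    have h5 : -(star (Λ₁ μ d x) ⬝ᵥ ![z - conj μ, 1]) + (z - conj μ) ^ 2 * psi' μ d z x =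
        -z * sn z x - d * cs z x := by
      rw [cs_sub_deriv_eq hμ]; simp [dotProduct, Fin.sum_univ_two]; ring
    rw [h3, Matrix.mulVec_sub, Matrix.mulVec_smul, Matrix.mulVec_smul] at h2
    simp only [Matrix.cons_val_zero, Matrix.cons_val_one]
    rw [← h4, ← h5, Matrix.mulVec_sub, Matrix.mulVec_smul]
    linear_combination (norm := module) (z - conj μ) ^ 2 • h1 + h2

theorem Λ_mul_J_mul (μ : ℂ) (d x : ℝ) : Λ μ d x * J * (Λ μ d x)ᴴ =
    Matrix.vecMulVec (Λ₁ μ d x) (star (Λ₂ μ d x)) -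
      Matrix.vecMulVec (Λ₂ μ d x) (star (Λ₁ μ d x)) := by
  ext i j
  simp [Λ, J, Matrix.mul_apply, Fin.sum_univ_two, Matrix.vecMulVec_apply,
    Matrix.conjTranspose_apply]
  ring

/-- By `det (1 + XY) = det (1 + YX)` and the Lyapunov identity, the determinant is that of `S (z -
A*) S⁻¹ (z - A)⁻¹`. -/
theorem det_darbouxMatrix {μ z : ℂ} (hμ : μ ≠ conj μ) (hz : z ≠ μ) (d : ℝ) {x : ℝ}
    (hx : 0 < x) : (darbouxMatrix (A μ) (S μ d x) (Λ μ d x) z).det =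
      (z - conj μ) ^ 2 / (z - μ) ^ 2 := by
  have hu := isUnit_det_sub_A hz
  set R := (z • (1 : Matrix (Fin 2) (Fin 2) ℂ) - A μ)⁻¹ with hR
  have hR1 : (z • (1 : Matrix (Fin 2) (Fin 2) ℂ) - A μ) * R = 1 := Matrix.mul_nonsing_inv _ hu
  have hSP := S_mul_inv hμ d hx
  set P := (S μ d x)⁻¹ with hP
  have key : 1 + Λ μ d x * (J * (Λ μ d x)ᴴ * P * R) =
      S μ d x * (z • (1 : Matrix (Fin 2) (Fin 2) ℂ) - (A μ)ᴴ) * P * R := by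
    have e1 : Λ μ d x * (J * (Λ μ d x)ᴴ * P * R) =
        (A μ * S μ d x - S μ d x * (A μ)ᴴ) * P * R := by
      rw [lyapunov_identity hμ, ← Λ_mul_J_mul]; noncomm_ring
    rw [e1]
    calc 1 + (A μ * S μ d x - S μ d x * (A μ)ᴴ) * P * R
        = (z • (1 : Matrix (Fin 2) (Fin 2) ℂ) - A μ) * R + A μ * (S μ d x * P) * R
          - S μ d x * (A μ)ᴴ * P * R := by rw [hR1]; noncomm_ring
      _ = z • (S μ d x * P) * R - S μ d x * (A μ)ᴴ * P * R := by
          rw [hSP]; noncomm_ring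
      _ = _ := by
          simp only [Matrix.mul_sub, Matrix.sub_mul, Matrix.mul_smul, Matrix.smul_mul,
            Matrix.mul_one]
  rw [darbouxMatrix, Matrix.det_one_add_mul_comm, ← hR, ← hP, key, Matrix.det_mul,
    Matrix.det_mul, Matrix.det_mul, det_sub_A_conjTranspose]
  have d1 : (z - μ) ^ 2 * R.det = 1 := by
    rw [← det_sub_A, ← Matrix.det_mul, hR1, Matrix.det_one]
  have d2 : (S μ d x).det * P.det = 1 := by rw [← Matrix.det_mul, hSP, Matrix.det_one]
  have h0 : (z - μ) ^ 2 ≠ 0 := pow_ne_zero _ (sub_ne_zero.2 hz)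
  rw [eq_div_iff h0]
  linear_combination ((S μ d x).det * P.det * (z - conj μ) ^ 2) * d1 + (z - conj μ) ^ 2 * d2

/-- For real `z` the Darboux matrix is `J`-unitary. -/
theorem darbouxMatrix_mul_J_mul {μ : ℂ} (hμ : μ ≠ conj μ) (r : ℝ) (d : ℝ) {x : ℝ}
    (hx : 0 < x) : darbouxMatrix (A μ) (S μ d x) (Λ μ d x) r * J *
      (darbouxMatrix (A μ) (S μ d x) (Λ μ d x) r)ᴴ = J := by
  have hr : (r : ℂ) ≠ μ := fun h => hμ (by rw [← h, Complex.conj_ofReal])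
  have hu := isUnit_det_sub_A hr
  have hSP := S_mul_inv hμ d hx
  have hPS := inv_S_mul hμ d hx
  have hPh : ((S μ d x)⁻¹)ᴴ = (S μ d x)⁻¹ := inv_S_isHermitian hμ d x
  rw [darbouxMatrix]
  have hly : Λ μ d x * J * (Λ μ d x)ᴴ = S μ d x * ((r : ℂ) • 1 - A μ)ᴴ -
      ((r : ℂ) • 1 - A μ) * S μ d x := by
    rw [Λ_mul_J_mul, ← lyapunov_identity hμ, Matrix.conjTranspose_sub,
      Matrix.conjTranspose_smul, Matrix.conjTranspose_one]
    simp [Matrix.mul_sub, Matrix.sub_mul]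
  set B := (r : ℂ) • (1 : Matrix (Fin 2) (Fin 2) ℂ) - A μ with hB
  set R := B⁻¹ with hR
  have hRB : R * B = 1 := Matrix.nonsing_inv_mul _ hu
  have hBR : Bᴴ * Rᴴ = 1 := by
    rw [← Matrix.conjTranspose_mul, hRB, Matrix.conjTranspose_one]
  set P := (S μ d x)⁻¹ with hP
  set L := Λ μ d x with hL
  set G := J * Lᴴ
  have hJ : (J : Matrix (Fin 2) (Fin 2) ℂ)ᴴ = -J := by
    ext i j; fin_cases i <;> fin_cases j <;> simp [J, Matrix.conjTranspose_apply]
  -- This resolvent form of the Lyapunov identity makes the quadratic term of the product cancel the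
  -- two linear ones.
  have e1 : P * R * (L * J * Lᴴ) * Rᴴ * P = P * R - Rᴴ * P := by
    rw [hly]
    calc P * R * (S μ d x * Bᴴ - B * S μ d x) * Rᴴ * P
        = P * R * S μ d x * (Bᴴ * Rᴴ) * P - P * (R * B) * S μ d x * Rᴴ * P := by noncomm_ring
      _ = P * R * (S μ d x * P) - (P * S μ d x) * Rᴴ * P := by rw [hBR, hRB]; noncomm_ring
      _ = _ := by rw [hSP, hPS]; noncomm_ring
  have e2 : (1 + G * P * R * L)ᴴ = 1 - Lᴴ * Rᴴ * P * L * J := by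
    simp only [G, Matrix.conjTranspose_add, Matrix.conjTranspose_mul, Matrix.conjTranspose_one,
      hPh, hJ, Matrix.conjTranspose_conjTranspose]
    noncomm_ring
  rw [e2]
  calc (1 + G * P * R * L) * J * (1 - Lᴴ * Rᴴ * P * L * J)
      = J + G * P * R * L * J - (J * Lᴴ) * Rᴴ * P * L * J -
          G * (P * R * (L * J * Lᴴ) * Rᴴ * P) * L * J := by noncomm_ring
    _ = J := by rw [e1]; change _ - G * Rᴴ * P * L * J - _ = _; noncomm_ring

/-- Every `2 × 2` matrix satisfies `M J Mᵀ = (det M) J`. Together with `M J M* = J` this forces the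
conjugate of `M` to be `M / det M`; the factor in front equals `1 / det M = conj (det M)`. -/
theorem conj_darbouxMatrix {μ : ℂ} (hμ : μ ≠ conj μ) (r : ℝ) (d : ℝ) {x : ℝ}
    (hx : 0 < x) (i j : Fin 2) :
    conj (darbouxMatrix (A μ) (S μ d x) (Λ μ d x) r i j) =
      (r - μ) ^ 2 / (r - conj μ) ^ 2 * darbouxMatrix (A μ) (S μ d x) (Λ μ d x) r i j := by
  have hr : (r : ℂ) ≠ μ := fun h => hμ (by rw [← h, Complex.conj_ofReal])
  have hJ := darbouxMatrix_mul_J_mul hμ r d hx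
  have hdet := congrArg conj (det_darbouxMatrix hμ hr d hx)
  set M := darbouxMatrix (A μ) (S μ d x) (Λ μ d x) r
  rw [map_div₀, map_pow, map_pow, map_sub, map_sub, Complex.conj_conj, Complex.conj_ofReal,
    Matrix.det_fin_two, map_sub, map_mul, map_mul] at hdet
  rw [← hdet]
  have e := fun i j => congrFun (congrFun hJ i) j
  have e00 := e 0 0
  have e01 := e 0 1
  have e10 := e 1 0
  have e11 := e 1 1
  simp only [Matrix.mul_apply, Fin.sum_univ_two, Matrix.conjTranspose_apply, J, Matrix.of_apply,
    Matrix.cons_val', Matrix.cons_val_zero, Matrix.cons_val_one, Matrix.cons_val_fin_one,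
    Complex.star_def] at e00 e01 e10 e11
  fin_cases i <;> fin_cases j <;> simp only [Fin.zero_eta, Fin.mk_one]
  · linear_combination -conj (M 0 0) * e01 + conj (M 1 0) * e00
  · linear_combination -conj (M 0 1) * e01 + conj (M 1 1) * e00
  · linear_combination conj (M 1 0) * e10 - conj (M 0 0) * e11
  · linear_combination conj (M 1 1) * e10 - conj (M 0 1) * e11

/-! ### Formulas, Wronskian and reality of `φ̃` and `θ̃` -/

theorem phi_eq {μ z : ℂ} (hμ : μ ≠ conj μ) (d : ℝ) {x : ℝ} (hx : 0 < x) (hz : z ≠ μ)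
    (hz' : z ≠ conj μ) :
    phi μ d z x = (yTilde μ d z x ⬝ᵥ ![1, -(d : ℂ)]) / (z - conj μ) ^ 2 := by
  have h0 : (z - conj μ) ^ 2 ≠ 0 := pow_ne_zero _ (sub_ne_zero.2 hz')
  rw [yTilde_dotProduct, darbouxMatrix_mulVec_phi hμ hz d hx, eq_div_iff h0]
  simp [mul_comm]

theorem theta_eq {μ z : ℂ} (d x : ℝ) (hz : z ≠ μ) :
    theta μ d z x = -(z - μ) ^ 2 * (yTilde μ d z x ⬝ᵥ ![0, 1]) := by
  have h := congrFun (darbouxMatrix_mulVec_theta hz d x) 0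
  rw [Pi.smul_apply, smul_eq_mul] at h
  rw [yTilde_dotProduct, h]
  rfl

theorem wronskian_theta_phi {μ : ℂ} (hμ : μ ≠ conj μ) (d : ℝ) (z : ℂ) {x : ℝ} (hx : 0 < x) :
    wronskian (theta μ d z) (phi μ d z) x = 1 := by
  rw [wronskian, (hasDerivAt_theta hμ d z hx).deriv, (hasDerivAt_phi hμ d z hx).deriv]
  have hc : Continuous fun z => theta μ d z x * phiDeriv μ d z x -
      thetaDeriv μ d z x * phi μ d z x :=
    ((differentiable_theta μ d x).continuous.mul (differentiable_phiDeriv hμ d x).continuous).sub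
      ((differentiable_thetaDeriv μ d x).continuous.mul (differentiable_phi hμ d x).continuous)
  -- Off the two exceptional points the Wronskian is read off from `det w_A` and `cs² + z sn² = 1`;
  -- continuity in `z` covers the points themselves.
  have hd : Dense (({μ, conj μ} : Set ℂ)ᶜ) :=
    Set.Countable.dense_compl ℂ (Set.toFinite _).countable
  refine congrFun (hc.ext_on hd continuous_const fun z hz => ?_) z
  obtain ⟨hz1, hz2⟩ : z ≠ μ ∧ z ≠ conj μ := by simpa using hz
  have h1 := darbouxMatrix_mulVec_theta hz1 d x
  have h2 := darbouxMatrix_mulVec_phi hμ hz1 d hx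
  have h3 := det_darbouxMatrix hμ hz1 d hx
  rw [w_mulVec_zero_one] at h1
  rw [w_mulVec_one_neg] at h2
  set M := darbouxMatrix (A μ) (S μ d x) (Λ μ d x) z
  have e10 := congrFun h1 0
  have e11 := congrFun h1 1
  have e20 := congrFun h2 0
  have e21 := congrFun h2 1
  have n1 : z - μ ≠ 0 := sub_ne_zero.2 hz1
  have n2 : (z - conj μ) ≠ 0 := sub_ne_zero.2 hz2
  rw [Matrix.det_fin_two, eq_div_iff (pow_ne_zero _ n1)] at h3
  simp only [Matrix.mulVec, dotProduct, Fin.sum_univ_two, Pi.smul_apply, smul_eq_mul,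
    Matrix.cons_val_zero, Matrix.cons_val_one, Matrix.cons_val_fin_one] at e10 e11 e20 e21
  have hq := cs_sq_add z x
  set θ := theta μ d z x
  set φ := phi μ d z x
  set a := gramQuotient μ d x
  refine mul_left_cancel₀ (pow_ne_zero 2 n2) ?_
  have e : (z - conj μ) ^ 2 * (θ * phiDeriv μ d z x - thetaDeriv μ d z x * φ) =
      θ * ((z - conj μ) ^ 2 * (phiDeriv μ d z x + a * φ)) -
        (thetaDeriv μ d z x + a * θ) * ((z - conj μ) ^ 2 * φ) := by ring
  rw [e, ← e20, ← e21, ← e11, ← e10]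
  linear_combination (cs z x ^ 2 + z * sn z x ^ 2) * h3 + (z - conj μ) ^ 2 * hq

/-- The factor is exactly what the prefactors `(z - μ̄)⁻²` of `φ̃` and `(z - μ)²` of `θ̃` absorb
under conjugation. -/
theorem conj_darbouxMatrix_mulVec {μ : ℂ} (hμ : μ ≠ conj μ) (r d : ℝ) {x : ℝ} (hx : 0 < x)
    {ξ : Fin 2 → ℂ} (hξ : ∀ i, conj (ξ i) = ξ i) :
    conj ((darbouxMatrix (A μ) (S μ d x) (Λ μ d x) r *ᵥ ξ) 0) = (r - μ) ^ 2 / (r - conj μ) ^ 2 *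
      (darbouxMatrix (A μ) (S μ d x) (Λ μ d x) r *ᵥ ξ) 0 := by
  simp only [Matrix.mulVec, dotProduct, Fin.sum_univ_two, map_add, map_mul, hξ,
    conj_darbouxMatrix hμ r d hx]
  ring

theorem ofReal_ne {μ : ℂ} (hμ : μ ≠ conj μ) (r : ℝ) : (r : ℂ) ≠ μ ∧ (r : ℂ) ≠ conj μ :=
  ⟨fun h => hμ (by rw [← h, Complex.conj_ofReal]),
    fun h => hμ (by
      have h' := congrArg conj h
      rw [Complex.conj_conj, Complex.conj_ofReal] at h'
      rw [← h', Complex.conj_ofReal])⟩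

theorem phi_im {μ : ℂ} (hμ : μ ≠ conj μ) (r d : ℝ) {x : ℝ} (hx : 0 < x) :
    (phi μ d r x).im = 0 := by
  obtain ⟨h1, h2⟩ := ofReal_ne hμ r
  have n1 : (r : ℂ) - μ ≠ 0 := sub_ne_zero.2 h1
  have n2 : (r : ℂ) - conj μ ≠ 0 := sub_ne_zero.2 h2
  rw [← Complex.conj_eq_iff_im, phi_eq hμ d hx h1 h2, yTilde_dotProduct, w_mulVec_one_neg, map_div₀,
    conj_darbouxMatrix_mulVec hμ r d hx]
  · simp only [map_pow, map_sub, Complex.conj_conj, Complex.conj_ofReal]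
    field_simp
  · intro i
    fin_cases i <;> simp [conj_cs, conj_sn]

theorem theta_im {μ : ℂ} (hμ : μ ≠ conj μ) (r d : ℝ) {x : ℝ} (hx : 0 < x) :
    (theta μ d r x).im = 0 := by
  obtain ⟨h1, h2⟩ := ofReal_ne hμ r
  have n1 : (r : ℂ) - μ ≠ 0 := sub_ne_zero.2 h1
  have n2 : (r : ℂ) - conj μ ≠ 0 := sub_ne_zero.2 h2
  rw [← Complex.conj_eq_iff_im, theta_eq d x h1, yTilde_dotProduct, w_mulVec_zero_one, map_mul,
    conj_darbouxMatrix_mulVec hμ r d hx]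
  · simp only [map_pow, map_sub, map_neg, Complex.conj_ofReal]
    field_simp
  · intro i
    fin_cases i <;> simp [conj_cs, conj_sn]

/-! ### The potential -/

theorem conj_dotProduct_inv_S {μ : ℂ} (hμ : μ ≠ conj μ) (d x : ℝ) (a b : Fin 2 → ℂ) :
    conj (star a ⬝ᵥ ((S μ d x)⁻¹ *ᵥ b)) = star b ⬝ᵥ ((S μ d x)⁻¹ *ᵥ a) := by
  have h : star (star a ⬝ᵥ ((S μ d x)⁻¹ *ᵥ b)) = star b ⬝ᵥ ((S μ d x)⁻¹ *ᵥ a) := by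
    rw [← Matrix.star_dotProduct_star, star_star, Matrix.star_mulVec,
      ← Matrix.dotProduct_mulVec, inv_S_isHermitian hμ d x]
  exact h

theorem qTilde_im {μ : ℂ} (hμ : μ ≠ conj μ) (d x : ℝ) : (qTilde μ d x).im = 0 := by
  rw [← Complex.conj_eq_iff_im, qTilde, transformedPotential]
  simp only [map_mul, map_add, map_pow, map_ofNat, conj_dotProduct_inv_S hμ]
  ring

theorem continuousOn_dotProduct_inv_S {μ : ℂ} (hμ : μ ≠ conj μ) (d : ℝ) {a b : ℝ → Fin 2 → ℂ}
    (ha : ∀ i, Continuous fun x => a x i) (hb : ∀ i, Continuous fun x => b x i) :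
    ContinuousOn (fun x => star (a x) ⬝ᵥ ((S μ d x)⁻¹ *ᵥ b x)) (Ioi 0) := by
  have hP : ∀ i j, ContinuousOn (fun x => (S μ d x)⁻¹ i j) (Ioi 0) := fun i j x hx =>
    (hasDerivAt_inv_S_apply hμ d hx i j).continuousAt.continuousWithinAt
  simp only [Matrix.mulVec, dotProduct]
  exact continuousOn_finsetSum _ fun i _ => (ha i).continuousOn.star.mul
    (continuousOn_finsetSum _ fun j _ => (hP i j).mul (hb j).continuousOn)

theorem continuousOn_qTilde {μ : ℂ} (hμ : μ ≠ conj μ) (d : ℝ) :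
    ContinuousOn (qTilde μ d) (Ioi 0) := by
  have h1 := continuous_Λ₁_apply hμ d
  have h2 := continuous_Λ₂_apply hμ d
  exact continuousOn_const.mul ((((continuousOn_dotProduct_inv_S hμ d h2 h2).pow 2).add
    (continuousOn_dotProduct_inv_S hμ d h1 h2)).add (continuousOn_dotProduct_inv_S hμ d h2 h1))

/-! ### Behaviour at the origin -/

/-- `h(x) = c + O(x)` as `x ↓ 0`. -/
def LimO (h : ℝ → ℂ) (c : ℂ) : Prop :=
  (fun x => h x - c) =O[𝓝[>] 0] fun x : ℝ => x

theorem tendsto_ofReal_zero : Tendsto (fun x : ℝ => x) (𝓝[>] 0) (𝓝 0) :=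
  tendsto_id.mono_left nhdsWithin_le_nhds

namespace LimO

variable {f g : ℝ → ℂ} {a b : ℂ}

theorem tendsto (hf : LimO f a) : Tendsto f (𝓝[>] 0) (𝓝 a) := by
  simpa using (Asymptotics.IsBigO.trans_tendsto hf tendsto_ofReal_zero).add_const a

theorem congr (hf : LimO f a) (h : ∀ x, 0 < x → g x = f x) (hab : b = a) : LimO g b := by
  subst hab
  refine hf.congr' ?_ EventuallyEq.rfl
  filter_upwards [self_mem_nhdsWithin] with x hx using by rw [h x hx]

theorem const (a : ℂ) : LimO (fun _ => a) a := by
  simpa [LimO] using Asymptotics.isBigO_zero (E' := ℂ) (fun x : ℝ => x) (𝓝[>] 0)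

theorem id : LimO (fun x => (x : ℂ)) 0 := by
  simp only [LimO, sub_zero]
  exact Asymptotics.IsBigO.of_norm_left (by
    simpa using (Asymptotics.isBigO_refl (fun x : ℝ => x) (𝓝[>] 0)).norm_left)

theorem add (hf : LimO f a) (hg : LimO g b) : LimO (fun x => f x + g x) (a + b) :=
  (Asymptotics.IsBigO.add hf hg).congr_left fun x => by ring

theorem neg (hf : LimO f a) : LimO (fun x => -f x) (-a) :=
  (Asymptotics.IsBigO.neg_left hf).congr_left fun x => by ring

theorem sub (hf : LimO f a) (hg : LimO g b) : LimO (fun x => f x - g x) (a - b) :=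
  (Asymptotics.IsBigO.sub hf hg).congr_left fun x => by ring

theorem mul (hf : LimO f a) (hg : LimO g b) : LimO (fun x => f x * g x) (a * b) := by
  have h1 : (fun x => (f x - a) * g x) =O[𝓝[>] 0] fun x : ℝ => x * (1 : ℝ) :=
    Asymptotics.IsBigO.mul hf (hg.tendsto.isBigO_one ℝ)
  have h2 : (fun x => a * (g x - b)) =O[𝓝[>] 0] fun x : ℝ => x :=
    Asymptotics.IsBigO.const_mul_left hg a
  simp only [mul_one] at h1
  exact (h1.add h2).congr_left fun x => by ring

theorem conjugate (hf : LimO f a) : LimO (fun x => conj (f x)) (conj a) := by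
  refine Asymptotics.IsBigO.of_norm_left ?_
  refine (Asymptotics.IsBigO.norm_left hf).congr_left fun x => ?_
  rw [← map_sub, Complex.norm_conj]

theorem inv (hf : LimO f a) (ha : a ≠ 0) : LimO (fun x => (f x)⁻¹) a⁻¹ := by
  have ht := hf.tendsto
  have h1 : (fun x => (f x * a)⁻¹) =O[𝓝[>] 0] fun _ : ℝ => (1 : ℝ) :=
    ((ht.mul_const a).inv₀ (mul_ne_zero ha ha)).isBigO_one ℝ
  have h2 := Asymptotics.IsBigO.mul (Asymptotics.IsBigO.neg_left hf) h1
  simp only [mul_one] at h2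
  refine h2.congr' ?_ EventuallyEq.rfl
  filter_upwards [ht.eventually_ne ha] with x hx
  field_simp
  ring

theorem of_hasDerivAt {f' : ℂ} (hf : HasDerivAt f f' 0) : LimO f (f 0) := by
  have h := hf.isBigO_sub
  simp only [sub_zero] at h
  exact h.mono nhdsWithin_le_nhds

/-- Primitives of functions with a power-like behaviour at the origin. -/
theorem integral (n : ℕ) (hc : Continuous f) (hf : LimO (fun t => f t / (t : ℂ) ^ n) a) :
    LimO (fun x => (∫ t in (0 : ℝ)..x, f t) / (x : ℂ) ^ (n + 1)) (a / (n + 1)) := by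
  obtain ⟨C, hC⟩ := Asymptotics.IsBigO.bound hf
  obtain ⟨δ, hδ, hδC⟩ := mem_nhdsGT_iff_exists_Ioo_subset.1 hC
  refine Asymptotics.IsBigO.of_bound C ?_
  filter_upwards [Ioo_mem_nhdsGT hδ] with x hx
  have hx0 : 0 < x := hx.1
  have hxc : (x : ℂ) ≠ 0 := by exact_mod_cast hx0.ne'
  have hn : (n + 1 : ℂ) ≠ 0 := by exact_mod_cast n.succ_ne_zero
  have hpow : ∫ t in (0 : ℝ)..x, a * (t : ℂ) ^ n = a * ((x : ℂ) ^ (n + 1) / (n + 1)) := by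
    rw [intervalIntegral.integral_const_mul]
    congr 1
    have := integral_pow (a := 0) (b := x) n
    have h2 : ∫ t in (0 : ℝ)..x, (t : ℂ) ^ n = ((∫ t in (0 : ℝ)..x, t ^ n : ℝ) : ℂ) := by
      rw [← intervalIntegral.integral_ofReal]
      push_cast
      rfl
    rw [h2, this]
    push_cast
    simp
  have e : (∫ t in (0 : ℝ)..x, f t) / (x : ℂ) ^ (n + 1) - a / (n + 1) =
      (∫ t in (0 : ℝ)..x, (f t - a * (t : ℂ) ^ n)) / (x : ℂ) ^ (n + 1) := by
    rw [intervalIntegral.integral_sub (hc.intervalIntegrable _ _)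
      (by apply Continuous.intervalIntegrable; fun_prop), hpow]
    field_simp
  have hb : ‖∫ t in (0 : ℝ)..x, (f t - a * (t : ℂ) ^ n)‖ ≤ C * x ^ (n + 1) * |x - 0| := by
    refine intervalIntegral.norm_integral_le_of_norm_le_const fun t ht => ?_
    rw [uIoc_of_le hx0.le] at ht
    have ht0 := ht.1
    have htc : (t : ℂ) ≠ 0 := by exact_mod_cast ht0.ne'
    have h3 : ‖f t / (t : ℂ) ^ n - a‖ ≤ C * ‖t‖ := hδC ⟨ht0, ht.2.trans_lt hx.2⟩
    rw [Real.norm_of_nonneg ht0.le] at h3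
    have hC0 : 0 ≤ C := by
      have := (norm_nonneg _).trans h3
      exact nonneg_of_mul_nonneg_left this ht0
    have h4 : f t - a * (t : ℂ) ^ n = (f t / (t : ℂ) ^ n - a) * (t : ℂ) ^ n := by
      field_simp
    rw [h4, norm_mul, norm_pow, Complex.norm_real, Real.norm_of_nonneg ht0.le]
    calc ‖f t / (t : ℂ) ^ n - a‖ * t ^ n ≤ C * t * t ^ n := by gcongr
      _ = C * t ^ (n + 1) := by ring
      _ ≤ C * x ^ (n + 1) := by gcongr; exact ht.2
  rw [e, norm_div, norm_pow, Complex.norm_real, Real.norm_of_nonneg hx0.le,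
    div_le_iff₀ (by positivity)]
  rw [sub_zero, abs_of_pos hx0] at hb
  linarith

end LimO

theorem limO_Λ₂_one {μ : ℂ} (hμ : μ ≠ conj μ) (d : ℝ) : LimO (fun x => Λ₂ μ d x 1) 1 :=
  (LimO.of_hasDerivAt (hasDerivAt_Λ₂_apply hμ d 0 1)).congr (fun _ _ => rfl) (by simp [Λ₂_at_zero])

theorem limO_Λ₁_one {μ : ℂ} (hμ : μ ≠ conj μ) (d : ℝ) : LimO (fun x => Λ₁ μ d x 1) d :=
  (LimO.of_hasDerivAt (hasDerivAt_Λ₁_one hμ d 0)).congr (fun _ _ => rfl) (by simp [Λ₁_at_zero hμ])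

theorem limO_Λ₁_zero {μ : ℂ} (hμ : μ ≠ conj μ) (d : ℝ) :
    LimO (fun x => Λ₁ μ d x 0 / x) 1 := by
  have hd := ((hasDerivAt_Λ₂_apply hμ d 0 0).const_mul μ).add (hasDerivAt_Λ₂_apply hμ d 0 1)
  have hc : Continuous fun x => μ * Λ₂ μ d x 0 + Λ₂ μ d x 1 :=
    ((continuous_Λ₂_apply hμ d 0).const_mul μ).add (continuous_Λ₂_apply hμ d 1)
  have h1 : LimO (fun x => (μ * Λ₂ μ d x 0 + Λ₂ μ d x 1) / (x : ℂ) ^ 0) 1 :=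
    (LimO.of_hasDerivAt hd).congr (fun x _ => by simp) (by simp [Λ₂_at_zero])
  refine (LimO.integral 0 hc h1).congr (fun x _ => ?_) (by simp)
  have := eq_of_hasDerivAt_eq (hasDerivAt_Λ₁_zero hμ d) (hasDerivAt_intervalIntegral_right hc)
    (by simp [Λ₁_at_zero hμ]) x
  rw [this]
  simp

/-- Two integrations starting from `Λ₂ 1 ~ 1`: the first gives `Λ₁ 0 ~ x`, the second `Λ₂ 0 ~
-x²/2`. -/
theorem limO_Λ₂_zero {μ : ℂ} (hμ : μ ≠ conj μ) (d : ℝ) :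
    LimO (fun x => Λ₂ μ d x 0 / (x : ℂ) ^ 2) (-1 / 2) := by
  have h1 : LimO (fun x => -Λ₁ μ d x 0 / (x : ℂ) ^ 1) (-1) :=
    (limO_Λ₁_zero hμ d).neg.congr (fun x _ => by ring) rfl
  have hc := (continuous_Λ₁_apply hμ d 0).neg
  refine (LimO.integral 1 hc h1).congr (fun x _ => ?_) (by norm_num)
  have := eq_of_hasDerivAt_eq (fun x => hasDerivAt_Λ₂_apply hμ d x 0)
    (hasDerivAt_intervalIntegral_right hc) (by simp [Λ₂_at_zero]) x
  rw [this]
  rfl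

theorem limO_S {μ : ℂ} (hμ : μ ≠ conj μ) (d : ℝ) :
    LimO (fun x => S μ d x 0 0 / (x : ℂ) ^ 5) (1 / 20) ∧
    LimO (fun x => S μ d x 0 1 / (x : ℂ) ^ 3) (-1 / 6) ∧
    LimO (fun x => S μ d x 1 0 / (x : ℂ) ^ 3) (-1 / 6) ∧
    LimO (fun x => S μ d x 1 1 / (x : ℂ)) 1 := by
  have hf := limO_Λ₂_zero hμ d
  have hg := limO_Λ₂_one hμ d
  have hc := fun i j => (continuous_Λ₂_apply hμ d i).mul (continuous_conj_Λ₂ hμ d j)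
  refine ⟨?_, ?_, ?_, ?_⟩
  · have h : LimO (fun x => Λ₂ μ d x 0 * conj (Λ₂ μ d x 0) / (x : ℂ) ^ 4) (1 / 4) :=
      (hf.mul hf.conjugate).congr (fun x hx => by simp; field_simp) (by simp [map_ofNat (starRingEnd ℂ) 2]; norm_num)
    exact (LimO.integral 4 (hc 0 0) h).congr (fun x _ => rfl) (by norm_num)
  · have h : LimO (fun x => Λ₂ μ d x 0 * conj (Λ₂ μ d x 1) / (x : ℂ) ^ 2) (-1 / 2) :=
      (hf.mul hg.conjugate).congr (fun x hx => by field_simp) (by simp)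
    exact (LimO.integral 2 (hc 0 1) h).congr (fun x _ => rfl) (by norm_num)
  · have h : LimO (fun x => Λ₂ μ d x 1 * conj (Λ₂ μ d x 0) / (x : ℂ) ^ 2) (-1 / 2) :=
      (hg.mul hf.conjugate).congr (fun x hx => by simp; field_simp) (by simp [map_ofNat (starRingEnd ℂ) 2])
    exact (LimO.integral 2 (hc 1 0) h).congr (fun x _ => rfl) (by norm_num)
  · have h : LimO (fun x => Λ₂ μ d x 1 * conj (Λ₂ μ d x 1) / (x : ℂ) ^ 0) 1 :=
      (hg.mul hg.conjugate).congr (fun x hx => by simp) (by simp)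
    exact (LimO.integral 0 (hc 1 1) h).congr (fun x _ => by simp [S_apply]) (by norm_num)

/-- The leading terms of the determinant do not cancel: `1/20 - 1/36 = 1/45`, whence `det S ~
x⁶/45`. -/
theorem limO_inv_S {μ : ℂ} (hμ : μ ≠ conj μ) (d : ℝ) :
    LimO (fun x => (S μ d x)⁻¹ 0 0 * (x : ℂ) ^ 5) 45 ∧
    LimO (fun x => (S μ d x)⁻¹ 0 1 * (x : ℂ) ^ 3) (15 / 2) ∧
    LimO (fun x => (S μ d x)⁻¹ 1 0 * (x : ℂ) ^ 3) (15 / 2) ∧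
    LimO (fun x => (S μ d x)⁻¹ 1 1 * (x : ℂ)) (9 / 4) := by
  obtain ⟨h00, h01, h10, h11⟩ := limO_S hμ d
  have hdet : LimO (fun x => ((S μ d x).det / (x : ℂ) ^ 6)⁻¹) 45 := by
    have h : LimO (fun x => (S μ d x).det / (x : ℂ) ^ 6) (1 / 45) :=
      ((h00.mul h11).sub (h01.mul h10)).congr (fun x hx => by
        have hxc : (x : ℂ) ≠ 0 := by exact_mod_cast hx.ne'
        rw [Matrix.det_fin_two]
        field_simp) (by norm_num)
    exact (h.inv (by norm_num)).congr (fun _ _ => rfl) (by norm_num)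
  have hx0 : ∀ x : ℝ, 0 < x → (x : ℂ) ≠ 0 := fun x hx => by exact_mod_cast hx.ne'
  have hD := fun {x : ℝ} (hx : 0 < x) => det_S_ne_zero hμ d hx
  refine ⟨?_, ?_, ?_, ?_⟩
  · refine (hdet.mul h11).congr (fun x hx => ?_) (by norm_num)
    have := hx0 x hx
    have := hD hx
    rw [inv_S_apply]
    simp
    field_simp
  · refine (hdet.mul h01.neg).congr (fun x hx => ?_) (by norm_num)
    have := hx0 x hx
    have := hD hx
    rw [inv_S_apply]
    simp
    field_simp
  · refine (hdet.mul h10.neg).congr (fun x hx => ?_) (by norm_num)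
    have := hx0 x hx
    have := hD hx
    rw [inv_S_apply]
    simp
    field_simp
  · refine (hdet.mul h00).congr (fun x hx => ?_) (by norm_num)
    have := hx0 x hx
    have := hD hx
    rw [inv_S_apply]
    simp
    field_simp

/-- The constant is `2 (6² - 15 - 15)`. -/
theorem limO_qTilde {μ : ℂ} (hμ : μ ≠ conj μ) (d : ℝ) :
    LimO (fun x => qTilde μ d x * (x : ℂ) ^ 2) 12 := by
  have hf := limO_Λ₂_zero hμ d
  have hg := limO_Λ₂_one hμ d
  have hp := limO_Λ₁_zero hμ d
  have hq := limO_Λ₁_one hμ d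
  obtain ⟨h00, h01, h10, h11⟩ := limO_inv_S hμ d
  have ha : LimO (fun x => (star (Λ₂ μ d x) ⬝ᵥ ((S μ d x)⁻¹ *ᵥ Λ₂ μ d x)) * x) 6 := by
    refine ((((hf.conjugate.mul h00).mul hf).add ((hf.conjugate.mul h01).mul hg)).add
      (((hg.conjugate.mul h10).mul hf).add ((hg.conjugate.mul h11).mul hg))).congr (fun x hx => ?_)
      (by simp [map_ofNat (starRingEnd ℂ) 2]; norm_num)
    have hxc : (x : ℂ) ≠ 0 := by exact_mod_cast hx.ne'
    simp [Matrix.mulVec, dotProduct, Fin.sum_univ_two]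
    field_simp
  have hm : LimO (fun x => (star (Λ₁ μ d x) ⬝ᵥ ((S μ d x)⁻¹ *ᵥ Λ₂ μ d x)) * x ^ 2) (-15) := by
    -- The terms with the second entry of `Λ₁` are of order `1/x` only, hence the extra factor `x`;
    -- so `d` does not enter the leading term.
    refine ((((hp.conjugate.mul h00).mul hf).add ((hp.conjugate.mul h01).mul hg)).add
      ((((hq.conjugate.mul h10).mul hf).add ((hq.conjugate.mul h11).mul hg)).mul LimO.id)).congr
      (fun x hx => ?_) (by simp; norm_num)
    have hxc : (x : ℂ) ≠ 0 := by exact_mod_cast hx.ne'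
    simp [Matrix.mulVec, dotProduct, Fin.sum_univ_two]
    field_simp
  refine ((LimO.const 2).mul (((ha.mul ha).add hm).add hm.conjugate)).congr (fun x hx => ?_)
    (by simp [map_ofNat (starRingEnd ℂ) 15]; norm_num)
  rw [map_mul, conj_dotProduct_inv_S hμ, map_pow, Complex.conj_ofReal, qTilde,
    transformedPotential]
  ring

/-- The bound `psi = O(x)` is enough: the negative powers of `x` in `S⁻¹` are balanced exactly by
those of `Λ₂` and of the integration in `phiV`. -/
theorem tendsto_phi {μ : ℂ} (hμ : μ ≠ conj μ) (d : ℝ) (z : ℂ) :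
    Tendsto (phi μ d z) (𝓝[>] 0) (𝓝 0) := by
  have hf := limO_Λ₂_zero hμ d
  have hg := limO_Λ₂_one hμ d
  obtain ⟨h00, h01, h10, h11⟩ := limO_inv_S hμ d
  have hψ : LimO (psi μ d z) 0 :=
    (LimO.of_hasDerivAt (hasDerivAt_psi hμ d z 0)).congr (fun _ _ => rfl) (by simp)
  have hc := fun i => (continuous_Λ₂_apply hμ d i).mul (continuous_psi_right hμ d z)
  have hv0 : LimO (fun x => phiV μ d z x 0 / (x : ℂ) ^ 3) 0 := by
    have h : LimO (fun x => Λ₂ μ d x 0 * psi μ d z x / (x : ℂ) ^ 2) 0 :=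
      (hf.mul hψ).congr (fun x hx => by ring) (by simp)
    exact (LimO.integral 2 (hc 0) h).neg.congr
      (fun x _ => by simp only [phiV, Pi.mul_apply]; ring) (by simp)
  have hv1 : LimO (fun x => phiV μ d z x 1 / (x : ℂ)) 0 := by
    have h : LimO (fun x => Λ₂ μ d x 1 * psi μ d z x / (x : ℂ) ^ 0) 0 :=
      (hg.mul hψ).congr (fun x hx => by simp) (by simp)
    exact (LimO.integral 0 (hc 1) h).neg.congr
      (fun x _ => by simp only [phiV, Pi.mul_apply]; ring) (by simp)
  have h : LimO (phi μ d z) 0 := by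
    refine (hψ.add ((((hf.conjugate.mul h00).mul hv0).add ((hf.conjugate.mul h01).mul hv1)).add
      (((hg.conjugate.mul h10).mul hv0).add ((hg.conjugate.mul h11).mul hv1)))).congr (fun x hx => ?_)
      (by simp)
    have hxc : (x : ℂ) ≠ 0 := by exact_mod_cast hx.ne'
    simp [phi, transform, Matrix.mulVec, dotProduct, Fin.sum_univ_two]
    field_simp
  exact h.tendsto

/-- A function that is continuous on `(0, ∞)` and has a limit at the origin is square integrable
near the origin. -/
theorem memLp_of_tendsto {f : ℝ → ℂ} (hc : ContinuousOn f (Ioi 0)) {l : ℂ}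
    (hl : Tendsto f (𝓝[>] 0) (𝓝 l)) (c : ℝ) : MemLp f 2 (volume.restrict (Ioo 0 c)) := by
  obtain ⟨δ, hδ, hδC⟩ := mem_nhdsGT_iff_exists_Ioo_subset.1
    (hl.norm.eventually (gt_mem_nhds (lt_add_one ‖l‖)))
  have hδ0 : (0 : ℝ) < δ := hδ
  obtain ⟨C, hC⟩ := (isCompact_Icc (a := δ) (b := c)).exists_bound_of_continuousOn
    (hc.mono fun x hx => hδ0.trans_le hx.1)
  refine MemLp.of_bound ((hc.mono fun x hx => hx.1).aestronglyMeasurable measurableSet_Ioo)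
    (max C (‖l‖ + 1)) ?_
  filter_upwards [ae_restrict_mem measurableSet_Ioo] with x hx
  by_cases hxδ : x < δ
  · exact le_max_of_le_right (le_of_lt (hδC ⟨hx.1, hxδ⟩))
  · exact le_max_of_le_left (hC x ⟨not_lt.1 hxδ, hx.2.le⟩)

/-! ### Boundedness of the potential at infinity -/

/-- A general solution of `(D² - ω²)² h = 0`. -/
noncomputable def expPoly (ω : ℂ) (ν : Fin 4 → ℂ) (t : ℝ) : ℂ :=
  Complex.exp (ω * t) * (ν 1 * t + ν 0) + Complex.exp (-ω * t) * (ν 3 * t + ν 2)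

/-- The coefficients of the derivative of `expPoly`. -/
def expPolyDeriv (ω : ℂ) (ν : Fin 4 → ℂ) : Fin 4 → ℂ :=
  ![ω * ν 0 + ν 1, ω * ν 1, -ω * ν 2 + ν 3, -ω * ν 3]

theorem hasDerivAt_expPoly (ω : ℂ) (ν : Fin 4 → ℂ) (t : ℝ) :
    HasDerivAt (expPoly ω ν) (expPoly ω (expPolyDeriv ω ν) t) t := by
  refine ((hasDerivAt_cexp_mul_affine ω (ν 1) (ν 0) t).add
    (hasDerivAt_cexp_mul_affine (-ω) (ν 3) (ν 2) t)).congr_deriv ?_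
  simp [expPoly, expPolyDeriv]
  ring

theorem expPoly_at_zero (ω : ℂ) (ν : Fin 4 → ℂ) : expPoly ω ν 0 = ν 0 + ν 2 := by
  simp [expPoly]

theorem continuous_expPoly (ω : ℂ) :
    Continuous fun p : (Fin 4 → ℂ) × ℝ => expPoly ω p.1 p.2 := by
  unfold expPoly
  fun_prop

theorem expPoly_deriv_eq_zero {ω : ℂ} {ν : Fin 4 → ℂ} (h : ∀ t ∈ Ioo (0 : ℝ) 1, expPoly ω ν t = 0) :
    ∀ t ∈ Ioo (0 : ℝ) 1, expPoly ω (expPolyDeriv ω ν) t = 0 := fun t ht =>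
  (hasDerivAt_expPoly ω ν t).unique ((hasDerivAt_const t 0).congr_of_eventuallyEq (by
    filter_upwards [isOpen_Ioo.mem_nhds ht] with s hs using h s hs))

theorem coeff_add_eq_zero {ω : ℂ} {ν : Fin 4 → ℂ} (h : ∀ t ∈ Ioo (0 : ℝ) 1, expPoly ω ν t = 0) :
    ν 0 + ν 2 = 0 := by
  rw [← expPoly_at_zero ω]
  have h1 : Tendsto (expPoly ω ν) (𝓝[>] 0) (𝓝 (expPoly ω ν 0)) :=
    (hasDerivAt_expPoly ω ν 0).continuousAt.tendsto.mono_left nhdsWithin_le_nhds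
  refine tendsto_nhds_unique h1 (tendsto_const_nhds.congr' ?_)
  filter_upwards [Ioo_mem_nhdsGT one_pos] with t ht using (h t ht).symm

/-- The derivatives of order `0` to `3` at `0` give four linear equations for the coefficients, and
this system is nonsingular for `ω ≠ 0`. -/
theorem eq_zero_of_expPoly_eq_zero {ω : ℂ} (hω : ω ≠ 0) {ν : Fin 4 → ℂ}
    (h : ∀ t ∈ Ioo (0 : ℝ) 1, expPoly ω ν t = 0) : ν = 0 := by
  have h1 := expPoly_deriv_eq_zero h
  have h2 := expPoly_deriv_eq_zero h1
  have h3 := expPoly_deriv_eq_zero h2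
  have e0 := coeff_add_eq_zero h
  have e1 := coeff_add_eq_zero h1
  have e2 := coeff_add_eq_zero h2
  have e3 := coeff_add_eq_zero h3
  simp only [expPolyDeriv, Matrix.cons_val] at e1 e2 e3
  have f1 : ν 1 - ν 3 = 0 := by
    have : (2 * ω) * (ν 1 - ν 3) = 0 := by linear_combination e2 - ω ^ 2 * e0
    simpa [hω] using this
  have f2 : ν 1 + ν 3 = 0 := by
    have : (2 * ω ^ 2) * (ν 1 + ν 3) = 0 := by linear_combination e3 - ω ^ 2 * e1
    simpa [hω] using this
  have g1 : ν 1 = 0 := by linear_combination (f1 + f2) / 2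
  have g3 : ν 3 = 0 := by linear_combination (f2 - f1) / 2
  have f3 : ν 0 - ν 2 = 0 := by
    have : ω * (ν 0 - ν 2) = 0 := by linear_combination e1 - g1 - g3
    simpa [hω] using this
  have g0 : ν 0 = 0 := by linear_combination (f3 + e0) / 2
  have g2 : ν 2 = 0 := by linear_combination (e0 - f3) / 2
  ext i
  fin_cases i <;> simp [g0, g1, g2, g3]

/-- Compactness of the unit sphere of coefficients yields a positive minimum; homogeneity does the
rest. -/
theorem exists_le_integral_expPoly {ω : ℂ} (hω : ω ≠ 0) :
    ∃ c : ℝ, 0 < c ∧ ∀ ν, c * ‖ν‖ ^ 2 ≤ ∫ t in (0 : ℝ)..1, ‖expPoly ω ν t‖ ^ 2 := by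
  have hc := continuous_expPoly ω
  have hcν : ∀ ν, Continuous (expPoly ω ν) := fun ν =>
    continuous_iff_continuousAt.2 fun t => (hasDerivAt_expPoly ω ν t).continuousAt
  have hΦ : Continuous fun ν : Fin 4 → ℂ => ∫ t in (0 : ℝ)..1, ‖expPoly ω ν t‖ ^ 2 := by
    refine intervalIntegral.continuous_parametric_intervalIntegral_of_continuous' ?_ _ _
    exact hc.norm.pow 2
  obtain ⟨ν₀, hν₀, hmin⟩ := (isCompact_sphere (0 : Fin 4 → ℂ) 1).exists_isMinOn
    (NormedSpace.sphere_nonempty.2 zero_le_one) hΦ.continuousOn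
  have hν₀1 : ‖ν₀‖ = 1 := by simpa using hν₀
  refine ⟨∫ t in (0 : ℝ)..1, ‖expPoly ω ν₀ t‖ ^ 2, ?_, fun ν => ?_⟩
  · refine intervalIntegral.integral_pos one_pos ((hcν ν₀).norm.pow 2).continuousOn
      (fun t _ => by positivity) ?_
    by_contra! hcon
    have : ν₀ = 0 := eq_zero_of_expPoly_eq_zero hω fun t ht => by
      have h2 : ‖expPoly ω ν₀ t‖ ^ 2 = 0 :=
        le_antisymm (hcon t (Ioo_subset_Icc_self ht)) (by positivity)
      simpa using h2
    rw [this] at hν₀1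
    simp at hν₀1
  · by_cases hν : ν = 0
    · subst hν
      simp only [norm_zero, ne_eq, OfNat.ofNat_ne_zero, not_false_eq_true, zero_pow, mul_zero]
      exact intervalIntegral.integral_nonneg zero_le_one fun t _ => by positivity
    · have hn : ‖ν‖ ≠ 0 := norm_ne_zero_iff.2 hν
      have hm := hmin (show ((‖ν‖⁻¹ : ℝ) : ℂ) • ν ∈ Metric.sphere (0 : Fin 4 → ℂ) 1 by
        simp [norm_smul, hn])
      have e : ∀ t, ‖expPoly ω (((‖ν‖⁻¹ : ℝ) : ℂ) • ν) t‖ ^ 2 =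
          (‖ν‖ ^ 2)⁻¹ * ‖expPoly ω ν t‖ ^ 2 := fun t => by
        have : expPoly ω (((‖ν‖⁻¹ : ℝ) : ℂ) • ν) t = ((‖ν‖⁻¹ : ℝ) : ℂ) * expPoly ω ν t := by
          simp only [expPoly, Pi.smul_apply, smul_eq_mul]
          ring
        rw [this, norm_mul, Complex.norm_real, norm_inv, norm_norm, mul_pow, inv_pow]
      simp only [mem_ofPred_eq, e, intervalIntegral.integral_const_mul] at hm
      rw [inv_mul_eq_div, le_div_iff₀ (by positivity)] at hm
      exact hm

/-- The coefficients of `t ↦ η* Λ₂(x - t)`. -/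
noncomputable def shiftCoeff (μ : ℂ) (d x : ℝ) (η : Fin 2 → ℂ) : Fin 4 → ℂ :=
  ![1 / 2 * Complex.exp (-(ω μ * x)) * (conj (η 0) * (c₃ μ d * x + c₄ μ d) + conj (η 1) * c₁ μ d),
    -(1 / 2 * Complex.exp (-(ω μ * x)) * (conj (η 0) * c₃ μ d)),
    1 / 2 * Complex.exp (ω μ * x) * (conj (η 0) * (c₅ μ d * x - c₄ μ d) + conj (η 1) * c₂ μ d),
    -(1 / 2 * Complex.exp (ω μ * x) * (conj (η 0) * c₅ μ d))]

theorem star_dotProduct_Λ₂_sub (μ : ℂ) (d x t : ℝ) (η : Fin 2 → ℂ) :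
    star η ⬝ᵥ Λ₂ μ d (x - t) = expPoly (ω μ) (shiftCoeff μ d x η) t := by
  have e1 : Complex.exp (-(ω μ * ((x - t : ℝ) : ℂ))) =
      Complex.exp (-(ω μ * x)) * Complex.exp (ω μ * t) := by
    rw [← Complex.exp_add]; push_cast; ring_nf
  have e2 : Complex.exp (ω μ * ((x - t : ℝ) : ℂ)) =
      Complex.exp (ω μ * x) * Complex.exp (-ω μ * t) := by
    rw [← Complex.exp_add]; push_cast; ring_nf
  simp only [dotProduct, Fin.sum_univ_two, Λ₂_zero_apply, Λ₂_one_apply, e1, e2, expPoly,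
    shiftCoeff, Matrix.cons_val, Pi.star_apply, Complex.star_def]
  push_cast
  ring

/-- The form of `S(x)` dominates its part over `[x - 1, x]`. In the variable `x - t` the integrand
there is an `expPoly` with the fixed exponent `ω`, so the lower bound `c ‖ν‖²` is uniform in `x`.
The same coefficients express `η* Λ₂(x)` and `η* Λ₁(x)`, as value and derivative at `0`. -/
theorem exists_norm_le_quadratic_form {μ : ℂ} (hμ : μ ≠ conj μ) (d : ℝ) :
    ∃ K : ℝ, 0 < K ∧ ∀ x, 1 ≤ x → ∀ η : Fin 2 → ℂ,
      ‖star η ⬝ᵥ Λ₂ μ d x‖ ^ 2 ≤ K * ‖star η ⬝ᵥ (S μ d x *ᵥ η)‖ ∧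
      ‖star η ⬝ᵥ Λ₁ μ d x‖ ^ 2 ≤ K * ‖star η ⬝ᵥ (S μ d x *ᵥ η)‖ := by
  obtain ⟨c, hc, hcν⟩ := exists_le_integral_expPoly (ω_ne_zero hμ)
  -- Chosen to bound `|ω ν₀ + ν₁ - ω ν₂ + ν₃|` by `k ‖ν‖`.
  set k := 2 * ‖ω μ‖ + 2 with hk
  have hk0 : 0 < k := by positivity
  refine ⟨k ^ 2 / c, by positivity, fun x hx η => ?_⟩
  set ν := shiftCoeff μ d x η with hν
  have hcη : Continuous fun t => ‖star η ⬝ᵥ Λ₂ μ d t‖ ^ 2 := by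
    simp only [dotProduct, Fin.sum_univ_two]
    exact ((continuous_const.mul (continuous_Λ₂_apply hμ d 0)).add
      (continuous_const.mul (continuous_Λ₂_apply hμ d 1))).norm.pow 2
  have hS : c * ‖ν‖ ^ 2 ≤ ‖star η ⬝ᵥ (S μ d x *ᵥ η)‖ := by
    have h0 : 0 ≤ ∫ t in (0 : ℝ)..(x - 1), ‖star η ⬝ᵥ Λ₂ μ d t‖ ^ 2 :=
      intervalIntegral.integral_nonneg (by linarith) fun t _ => by positivity
    have h1 : ∫ t in (x - 1)..x, ‖star η ⬝ᵥ Λ₂ μ d t‖ ^ 2 =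
        ∫ t in (0 : ℝ)..1, ‖expPoly (ω μ) ν t‖ ^ 2 := by
      have := intervalIntegral.integral_comp_sub_left (a := 0) (b := 1)
        (fun t => ‖star η ⬝ᵥ Λ₂ μ d t‖ ^ 2) x
      rw [sub_zero] at this
      rw [← this]
      simp only [star_dotProduct_Λ₂_sub, hν]
    have h2 := intervalIntegral.integral_add_adjacent_intervals
      (hcη.intervalIntegrable (μ := volume) 0 (x - 1)) (hcη.intervalIntegrable (x - 1) x)
    rw [quadratic_form_S hμ, Complex.norm_real, ← h2, h1]
    have h3 := hcν ν
    rw [Real.norm_of_nonneg (by nlinarith [sq_nonneg ‖ν‖])]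
    linarith
  have hνi : ∀ i, ‖ν i‖ ≤ ‖ν‖ := norm_le_pi_norm ν
  have b2 : ‖star η ⬝ᵥ Λ₂ μ d x‖ ≤ k * ‖ν‖ := by
    have e : star η ⬝ᵥ Λ₂ μ d x = ν 0 + ν 2 := by
      rw [← expPoly_at_zero (ω μ), hν, ← star_dotProduct_Λ₂_sub, sub_zero]
    rw [e]
    have := norm_add_le (ν 0) (ν 2)
    have := hνi 0
    have := hνi 2
    have : 0 ≤ ‖ω μ‖ * ‖ν‖ := by positivity
    rw [hk]
    nlinarith
  have b1 : ‖star η ⬝ᵥ Λ₁ μ d x‖ ≤ k * ‖ν‖ := by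
    have e : star η ⬝ᵥ Λ₁ μ d x = (ω μ * ν 0 + ν 1) + (-ω μ * ν 2 + ν 3) := by
      have h1 := hasDerivAt_expPoly (ω μ) ν 0
      rw [expPoly_at_zero] at h1
      have h2 : HasDerivAt (fun t : ℝ => star η ⬝ᵥ Λ₂ μ d (x - t)) (star η ⬝ᵥ Λ₁ μ d x) 0 := by
        have h3 : ∀ i, HasDerivAt (fun t : ℝ => Λ₂ μ d (x - t) i) (Λ₁ μ d x i) 0 := fun i => by
          have h4 := hasDerivAt_Λ₂_apply hμ d (x - 0) i
          have h5 := h4.scomp (0 : ℝ) ((hasDerivAt_id (0 : ℝ)).const_sub x)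
          exact h5.congr_deriv (by simp)
        simp only [dotProduct, Fin.sum_univ_two]
        exact ((h3 0).const_mul _).add ((h3 1).const_mul _)
      rw [show (fun t : ℝ => star η ⬝ᵥ Λ₂ μ d (x - t)) = expPoly (ω μ) ν from
        funext fun t => star_dotProduct_Λ₂_sub μ d x t η] at h2
      rw [h2.unique h1]
      rfl
    rw [e]
    have n1 := norm_add_le (ω μ * ν 0 + ν 1) (-ω μ * ν 2 + ν 3)
    have n2 := norm_add_le (ω μ * ν 0) (ν 1)
    have n3 := norm_add_le (-ω μ * ν 2) (ν 3)
    rw [norm_mul] at n2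
    rw [norm_mul, norm_neg] at n3
    have m0 := mul_le_mul_of_nonneg_left (hνi 0) (norm_nonneg (ω μ))
    have m2 := mul_le_mul_of_nonneg_left (hνi 2) (norm_nonneg (ω μ))
    have := hνi 1
    have := hνi 3
    rw [hk]
    linarith
  have hfin : ∀ r : ℝ, 0 ≤ r → r ≤ k * ‖ν‖ →
      r ^ 2 ≤ k ^ 2 / c * ‖star η ⬝ᵥ (S μ d x *ᵥ η)‖ := fun r hr hrk => by
    calc r ^ 2 ≤ (k * ‖ν‖) ^ 2 := by gcongr
      _ = k ^ 2 / c * (c * ‖ν‖ ^ 2) := by field_simp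
      _ ≤ _ := by gcongr
  exact ⟨hfin _ (norm_nonneg _) b2, hfin _ (norm_nonneg _) b1⟩

/-- Taking `η = S⁻¹ Λ₂` in `exists_norm_le_quadratic_form` gives `|a|² ≤ K |a|` and `|m|² ≤ K |a|`,
so both are at most `K`. -/
theorem exists_norm_qTilde_le {μ : ℂ} (hμ : μ ≠ conj μ) (d : ℝ) :
    ∃ B : ℝ, ∀ x, 1 ≤ x → ‖qTilde μ d x‖ ≤ B := by
  obtain ⟨K, hK, h⟩ := exists_norm_le_quadratic_form hμ d
  refine ⟨2 * (K ^ 2 + K + K), fun x hx => ?_⟩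
  have hx0 : 0 < x := by linarith
  set a := star (Λ₂ μ d x) ⬝ᵥ ((S μ d x)⁻¹ *ᵥ Λ₂ μ d x) with ha
  set m := star (Λ₁ μ d x) ⬝ᵥ ((S μ d x)⁻¹ *ᵥ Λ₂ μ d x) with hm
  obtain ⟨h2, h1⟩ := h x hx ((S μ d x)⁻¹ *ᵥ Λ₂ μ d x)
  have e : ∀ b, star ((S μ d x)⁻¹ *ᵥ Λ₂ μ d x) ⬝ᵥ b =
      star (Λ₂ μ d x) ⬝ᵥ ((S μ d x)⁻¹ *ᵥ b) := fun b => by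
    rw [Matrix.star_mulVec, ← Matrix.dotProduct_mulVec, inv_S_isHermitian hμ d x]
  have hm' : ‖star (Λ₂ μ d x) ⬝ᵥ ((S μ d x)⁻¹ *ᵥ Λ₁ μ d x)‖ = ‖m‖ := by
    rw [← conj_dotProduct_inv_S hμ, Complex.norm_conj]
  rw [Matrix.mulVec_mulVec, S_mul_inv hμ d hx0, Matrix.one_mulVec] at h1 h2
  rw [e, ← ha] at h2
  rw [e, e, ← ha, hm'] at h1
  have ha1 : ‖a‖ ≤ K := by
    by_contra! hcon
    nlinarith [norm_nonneg a]
  have hm1 : ‖m‖ ≤ K := by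
    by_contra! hcon
    nlinarith [norm_nonneg a, norm_nonneg m]
  rw [qTilde, transformedPotential, ← ha, ← hm, norm_mul]
  have n1 := norm_add_le (a ^ 2 + m) (star (Λ₂ μ d x) ⬝ᵥ ((S μ d x)⁻¹ *ᵥ Λ₁ μ d x))
  have n2 := norm_add_le (a ^ 2) m
  rw [norm_pow] at n2
  have n3 : ‖a‖ ^ 2 ≤ K ^ 2 := by gcongr
  have n4 : ‖(2 : ℂ)‖ = 2 := by simp
  rw [n4]
  linarith

/-! ### Solutions and Wronskians -/

theorem IsSolution.hasDerivAt {q : ℝ → ℂ} {z : ℂ} {y : ℝ → ℂ} (h : IsSolution q z y) {x : ℝ}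
    (hx : 0 < x) : HasDerivAt y (deriv y x) x :=
  (h x hx).1.hasDerivAt

theorem IsSolution.hasDerivAt_deriv {q : ℝ → ℂ} {z : ℂ} {y : ℝ → ℂ} (h : IsSolution q z y)
    {x : ℝ} (hx : 0 < x) : HasDerivAt (deriv y) ((q x - z) * y x) x :=
  (h x hx).2.1.hasDerivAt.congr_deriv (by linear_combination -(h x hx).2.2)

theorem IsSolution.continuousOn {q : ℝ → ℂ} {z : ℂ} {y : ℝ → ℂ} (h : IsSolution q z y) :
    ContinuousOn y (Ioi 0) :=
  fun _ hx => (h.hasDerivAt hx).continuousAt.continuousWithinAt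

theorem IsSolution.continuousOn_deriv {q : ℝ → ℂ} {z : ℂ} {y : ℝ → ℂ} (h : IsSolution q z y) :
    ContinuousOn (deriv y) (Ioi 0) :=
  fun _ hx => (h.hasDerivAt_deriv hx).continuousAt.continuousWithinAt

theorem IsSolution.add_const_mul {q : ℝ → ℂ} {z : ℂ} {y₁ y₂ : ℝ → ℂ} (h₁ : IsSolution q z y₁)
    (h₂ : IsSolution q z y₂) (m : ℂ) : IsSolution q z fun x => y₁ x + m * y₂ x :=
  isSolution_of_hasDerivAt
    (fun _ hx => (h₁.hasDerivAt hx).add ((h₂.hasDerivAt hx).const_mul m))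
    (fun _ hx => (h₁.hasDerivAt_deriv hx).add ((h₂.hasDerivAt_deriv hx).const_mul m))
    fun x _ => by ring

theorem wronskian_const {q : ℝ → ℂ} {z : ℂ} {y₁ y₂ : ℝ → ℂ} (h₁ : IsSolution q z y₁)
    (h₂ : IsSolution q z y₂) {x x' : ℝ} (hx : 0 < x) (hx' : 0 < x') :
    wronskian y₁ y₂ x = wronskian y₁ y₂ x' := by
  have hd : ∀ t, 0 < t → HasDerivAt (wronskian y₁ y₂) 0 t := fun t ht =>
    (((h₁.hasDerivAt ht).mul (h₂.hasDerivAt_deriv ht)).sub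
      ((h₁.hasDerivAt_deriv ht).mul (h₂.hasDerivAt ht))).congr_deriv (by ring)
  exact isOpen_Ioi.is_const_of_deriv_eq_zero isPreconnected_Ioi
    (fun t ht => (hd t ht).differentiableAt.differentiableWithinAt) (fun t ht => (hd t ht).deriv)
    hx hx'

/-! ### The limit point case at infinity -/

theorem memLp_two_Ioi_iff {y : ℝ → ℂ} (hy : ContinuousOn y (Ioi 0)) {c : ℝ} (hc : 0 < c) :
    MemLp y 2 (volume.restrict (Ioi c)) ↔ IntegrableOn (fun x => ‖y x‖ ^ 2) (Ioi c) :=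
  memLp_two_iff_integrable_sq_norm
    ((hy.mono fun _ hx => hc.trans hx).aestronglyMeasurable measurableSet_Ioi)

theorem integrableOn_norm_sq_of_bounded {y : ℝ → ℂ} (hy : ContinuousOn y (Ioi 0)) {c : ℝ}
    (hc : 0 < c) {I : ℝ} (h : ∀ x, c ≤ x → ∫ t in c..x, ‖y t‖ ^ 2 ≤ I) :
    IntegrableOn (fun x => ‖y x‖ ^ 2) (Ioi c) := by
  refine integrableOn_Ioi_of_intervalIntegral_norm_bounded I c (l := atTop) (b := fun x : ℝ => x)
    (fun x => ?_) tendsto_id ?_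
  · refine (ContinuousOn.integrableOn_Icc ?_).mono_set Ioc_subset_Icc_self
    exact (hy.norm.pow 2).mono fun t ht => hc.trans_le ht.1
  · filter_upwards [eventually_ge_atTop c] with x hx
    simpa using h x hx

theorem not_integrableOn_of_le {f : ℝ → ℝ} {c ε : ℝ} (hε : 0 < ε) (h : ∀ x, c < x → ε ≤ f x) :
    ¬IntegrableOn f (Ioi c) := by
  intro hf
  have h1 : IntegrableOn (fun _ : ℝ => ε) (Ioi c) := by
    refine Integrable.mono' hf aestronglyMeasurable_const ?_
    filter_upwards [ae_restrict_mem measurableSet_Ioi] with x hx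
    rw [Real.norm_of_nonneg hε.le]
    exact h x hx
  rw [integrableOn_const_iff] at h1
  simp [hε.ne'] at h1

theorem hasDerivAt_norm_sq {y : ℝ → ℂ} {y' : ℂ} {x : ℝ} (h : HasDerivAt y y' x) :
    HasDerivAt (fun x => ‖y x‖ ^ 2) (2 * (conj (y x) * y').re) x := by
  have h1 := (h.mul (hasDerivAt_conj_comp h))
  have h2 := Complex.reCLM.hasFDerivAt.comp_hasDerivAt x h1
  have e : (fun x => ‖y x‖ ^ 2) = Complex.reCLM ∘ (y * fun x => conj (y x)) := by
    ext t
    simp [Complex.mul_conj, Complex.normSq_eq_norm_sq, -Complex.ofReal_pow]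
  rw [e]
  refine h2.congr_deriv ?_
  simp
  ring

/-- The derivative of a square integrable solution is square integrable at infinity if the
potential is bounded there. -/
theorem IsSolution.integrableOn_deriv {q : ℝ → ℂ} {z : ℂ} {y : ℝ → ℂ} (h : IsSolution q z y)
    (hq : ContinuousOn q (Ioi 0)) {B : ℝ} (hB : ∀ x, 1 ≤ x → ‖q x‖ ≤ B)
    (hy : IntegrableOn (fun x => ‖y x‖ ^ 2) (Ioi 1)) :
    IntegrableOn (fun x => ‖deriv y x‖ ^ 2) (Ioi 1) := by
  have hyc := h.continuousOn
  have hyc' := h.continuousOn_deriv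
  set C := B + ‖z‖ with hC
  have hC0 : 0 ≤ C := add_nonneg ((norm_nonneg _).trans (hB 1 le_rfl)) (norm_nonneg _)
  set N := ∫ t in Ioi (1 : ℝ), ‖y t‖ ^ 2 with hN
  have hii : ∀ {f : ℝ → ℝ} {a b : ℝ}, ContinuousOn f (Ioi 0) → 1 ≤ a → a ≤ b →
      IntervalIntegrable f volume a b := fun hf ha hab => by
    refine ContinuousOn.intervalIntegrable (hf.mono fun t ht => ?_)
    rw [uIcc_of_le hab] at ht
    exact lt_of_lt_of_le (by linarith) ht.1
  have c1 : ContinuousOn (fun t => ‖y t‖ ^ 2) (Ioi 0) := hyc.norm.pow 2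
  have c2 : ContinuousOn (fun t => ‖deriv y t‖ ^ 2) (Ioi 0) := hyc'.norm.pow 2
  -- `G` is half the derivative of `|y|²`, and `G'` is `|y'|²` plus a term bounded by `C |y|²`. If
  -- `∫ |y'|²` diverged, `G` would eventually exceed `1` and `|y|²` would grow linearly.
  set G : ℝ → ℝ := fun x => (conj (y x) * deriv y x).re with hG
  have hGd : ∀ x, 0 < x → HasDerivAt G (‖deriv y x‖ ^ 2 +
      (conj (y x) * ((q x - z) * y x)).re) x := fun x hx => by
    have h1 := (hasDerivAt_conj_comp (h.hasDerivAt hx)).mul (h.hasDerivAt_deriv hx)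
    refine (Complex.reCLM.hasFDerivAt.comp_hasDerivAt x h1).congr_deriv ?_
    rw [Complex.reCLM_apply, Complex.add_re, ← Complex.normSq_eq_norm_sq,
      mul_comm (conj (deriv y x)), Complex.mul_conj, Complex.ofReal_re]
  have c3 : ContinuousOn (fun x => (conj (y x) * ((q x - z) * y x)).re) (Ioi 0) :=
    Complex.continuous_re.comp_continuousOn ((Complex.continuous_conj.comp_continuousOn hyc).mul
      ((hq.sub continuousOn_const).mul hyc))
  have hGle : ∀ x, 1 ≤ x → G 1 + (∫ t in (1 : ℝ)..x, ‖deriv y t‖ ^ 2) - C * N ≤ G x := by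
    intro x hx
    have e : ∫ t in (1 : ℝ)..x, (‖deriv y t‖ ^ 2 + (conj (y t) * ((q t - z) * y t)).re) =
        G x - G 1 := by
      refine intervalIntegral.integral_eq_sub_of_hasDerivAt (fun t ht => hGd t ?_)
        (hii (c2.add c3) le_rfl hx)
      rw [uIcc_of_le hx] at ht
      linarith [ht.1]
    rw [intervalIntegral.integral_add (hii c2 le_rfl hx) (hii c3 le_rfl hx)] at e
    have e2 : -(C * ∫ t in (1 : ℝ)..x, ‖y t‖ ^ 2) ≤
        ∫ t in (1 : ℝ)..x, (conj (y t) * ((q t - z) * y t)).re := by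
      rw [← intervalIntegral.integral_const_mul, ← intervalIntegral.integral_neg]
      refine intervalIntegral.integral_mono_on hx
        (hii (continuousOn_const.mul c1).neg le_rfl hx) (hii c3 le_rfl hx) fun t ht => ?_
      have h1 := neg_le_of_abs_le (Complex.abs_re_le_norm (conj (y t) * ((q t - z) * y t)))
      have h2 : ‖conj (y t) * ((q t - z) * y t)‖ ≤ C * ‖y t‖ ^ 2 := by
        rw [norm_mul, norm_mul, Complex.norm_conj]
        have h3 : ‖q t - z‖ ≤ C := (norm_sub_le _ _).trans (add_le_add (hB t ht.1) le_rfl)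
        calc ‖y t‖ * (‖q t - z‖ * ‖y t‖) = ‖q t - z‖ * ‖y t‖ ^ 2 := by ring
          _ ≤ _ := by gcongr
      linarith
    have e3 : ∫ t in (1 : ℝ)..x, ‖y t‖ ^ 2 ≤ N := by
      rw [intervalIntegral.integral_of_le hx]
      exact setIntegral_mono_set hy (Eventually.of_forall fun t => by positivity)
        Ioc_subset_Ioi_self.eventuallyLE
    have e4 := mul_le_mul_of_nonneg_left e3 hC0
    linarith
  by_cases hbdd : ∃ I, ∀ x, 1 ≤ x → ∫ t in (1 : ℝ)..x, ‖deriv y t‖ ^ 2 ≤ I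
  · obtain ⟨I, hI⟩ := hbdd
    exact integrableOn_norm_sq_of_bounded hyc' one_pos hI
  · exfalso
    push Not at hbdd
    -- This threshold is the one that `hGle` turns into `G ≥ 1` beyond `X`.
    obtain ⟨X, hX1, hX⟩ := hbdd (1 + C * N - G 1)
    have hG1 : ∀ x, X ≤ x → 1 ≤ G x := fun x hx => by
      have h1 := hGle x (hX1.trans hx)
      have h2 := intervalIntegral.integral_add_adjacent_intervals (hii c2 le_rfl hX1)
        (hii c2 hX1 hx)
      have h3 : 0 ≤ ∫ t in X..x, ‖deriv y t‖ ^ 2 :=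
        intervalIntegral.integral_nonneg hx fun t _ => by positivity
      linarith
    have hlow : ∀ x, X ≤ x → 2 * (x - X) ≤ ‖y x‖ ^ 2 := fun x hx => by
      have e : ∫ t in X..x, 2 * G t = ‖y x‖ ^ 2 - ‖y X‖ ^ 2 := by
        refine intervalIntegral.integral_eq_sub_of_hasDerivAt
          (fun t ht => hasDerivAt_norm_sq (h.hasDerivAt ?_)) (hii ?_ hX1 hx)
        · rw [uIcc_of_le hx] at ht
          linarith [ht.1]
        · exact continuousOn_const.mul fun t ht => (hGd t ht).continuousAt.continuousWithinAt
      have e2 : ∫ _ in X..x, (2 : ℝ) ≤ ∫ t in X..x, 2 * G t := by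
        refine intervalIntegral.integral_mono_on hx intervalIntegrable_const (hii ?_ hX1 hx)
          fun t ht => by linarith [hG1 t ht.1]
        exact continuousOn_const.mul fun t ht => (hGd t ht).continuousAt.continuousWithinAt
      rw [intervalIntegral.integral_const, smul_eq_mul] at e2
      nlinarith [sq_nonneg ‖y X‖]
    refine not_integrableOn_of_le (c := X + 1) (ε := 2) two_pos (fun x hx => ?_)
      (hy.mono_set (Ioi_subset_Ioi (by linarith)))
    have := hlow x (by linarith)
    linarith

/-- Square integrable solutions are proportional if the potential is bounded at infinity. -/
theorem wronskian_eq_zero {q : ℝ → ℂ} {z : ℂ} {y₁ y₂ : ℝ → ℂ} (h₁ : IsSolution q z y₁)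
    (h₂ : IsSolution q z y₂) (hq : ContinuousOn q (Ioi 0)) {B : ℝ}
    (hB : ∀ x, 1 ≤ x → ‖q x‖ ≤ B) (hy₁ : MemLp y₁ 2 (volume.restrict (Ioi 1)))
    (hy₂ : MemLp y₂ 2 (volume.restrict (Ioi 1))) {x : ℝ} (hx : 0 < x) :
    wronskian y₁ y₂ x = 0 := by
  have hd₁ := (memLp_two_Ioi_iff h₁.continuousOn_deriv one_pos).2 (h₁.integrableOn_deriv hq hB
    ((memLp_two_Ioi_iff h₁.continuousOn one_pos).1 hy₁))
  have hd₂ := (memLp_two_Ioi_iff h₂.continuousOn_deriv one_pos).2 (h₂.integrableOn_deriv hq hB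
    ((memLp_two_Ioi_iff h₂.continuousOn one_pos).1 hy₂))
  -- Products of square integrable functions are integrable, whereas a nonzero constant is not
  -- integrable on a half-line.
  have hi : IntegrableOn (wronskian y₁ y₂) (Ioi 1) :=
    (hy₁.integrable_mul hd₂).sub (hd₁.integrable_mul hy₂)
  by_contra hne
  refine not_integrableOn_of_le (norm_pos_iff.2 hne) (fun t ht => ?_) hi.norm
  rw [wronskian_const h₁ h₂ hx (one_pos.trans ht)]

/-! ### The Weyl solution -/

/-- The transformation does not increase the `L²` norm at infinity. -/
theorem integrableOn_transform {μ : ℂ} (hμ : μ ≠ conj μ) (d : ℝ) {u : ℝ → ℂ}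
    {v : ℝ → Fin 2 → ℂ} (hu : Continuous u) (hv : ∀ x, HasDerivAt v (-(u x • Λ₂ μ d x)) x)
    (hy : ContinuousOn (transform μ d u v) (Ioi 0)) {c : ℝ} (hc : 0 < c)
    (hui : IntegrableOn (fun x => ‖u x‖ ^ 2) (Ioi c)) :
    IntegrableOn (fun x => ‖transform μ d u v x‖ ^ 2) (Ioi c) := by
  -- An energy with `E ≥ 0` and `E' = |u|² - |ũ|²`, which bounds `∫ |ũ|²` by `∫ |u|² + E c`.
  set E : ℝ → ℝ := fun x => (star (v x) ⬝ᵥ ((S μ d x)⁻¹ *ᵥ v x)).re with hE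
  have hE0 : ∀ x, 0 < x → 0 ≤ E x := fun x hx =>
    (Complex.nonneg_iff.1 ((S_posDef hμ d hx).inv.posSemidef.dotProduct_mulVec_nonneg (v x))).1
  have hEd : ∀ x, 0 < x → HasDerivAt E (‖u x‖ ^ 2 - ‖transform μ d u v x‖ ^ 2) x := fun x hx => by
    have h := hasDerivAt_star_dotProduct (hv x) (hasDerivAt_inv_S_mulVec_pair hμ d hx (hv x))
    refine (Complex.reCLM.hasFDerivAt.comp_hasDerivAt x h).congr_deriv ?_
    have hs := conj_dotProduct_inv_S hμ d x (Λ₂ μ d x) (v x)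
    rw [star_neg, star_smul, neg_dotProduct, smul_dotProduct, dotProduct_neg, dotProduct_smul,
      ← hs, transform]
    set s := star (Λ₂ μ d x) ⬝ᵥ ((S μ d x)⁻¹ *ᵥ v x)
    rw [← Complex.normSq_eq_norm_sq, ← Complex.normSq_eq_norm_sq]
    simp [Complex.normSq_apply]
    ring
  have hii : ∀ {f : ℝ → ℝ} {x : ℝ}, ContinuousOn f (Ioi 0) → c ≤ x →
      IntervalIntegrable f volume c x := fun hf hx => by
    refine ContinuousOn.intervalIntegrable (hf.mono fun t ht => ?_)
    rw [uIcc_of_le hx] at ht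
    exact hc.trans_le ht.1
  have c1 : ContinuousOn (fun t => ‖u t‖ ^ 2) (Ioi 0) := (hu.norm.pow 2).continuousOn
  have c2 : ContinuousOn (fun t => ‖transform μ d u v t‖ ^ 2) (Ioi 0) := hy.norm.pow 2
  refine integrableOn_norm_sq_of_bounded hy hc (I := (∫ t in Ioi c, ‖u t‖ ^ 2) + E c)
    fun x hx => ?_
  have e : ∫ t in c..x, (‖u t‖ ^ 2 - ‖transform μ d u v t‖ ^ 2) = E x - E c := by
    refine intervalIntegral.integral_eq_sub_of_hasDerivAt (fun t ht => hEd t ?_)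
      (hii (c1.sub c2) hx)
    rw [uIcc_of_le hx] at ht
    exact hc.trans_le ht.1
  rw [intervalIntegral.integral_sub (hii c1 hx) (hii c2 hx)] at e
  have e3 : ∫ t in c..x, ‖u t‖ ^ 2 ≤ ∫ t in Ioi c, ‖u t‖ ^ 2 := by
    rw [intervalIntegral.integral_of_le hx]
    exact setIntegral_mono_set hui (Eventually.of_forall fun t => by positivity)
      Ioc_subset_Ioi_self.eventuallyLE
  have := hE0 x (hc.trans_le hx)
  linarith

theorem cs_add_sn (z : ℂ) (x : ℝ) :
    cs z x + Complex.I * sqrtUp z * sn z x = Complex.exp (Complex.I * sqrtUp z * x) := by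
  have h1 := cs_sq (sqrtUp z) x
  have h2 := mul_sn_sq (sqrtUp z) x
  rw [sqrtUp_sq] at h1 h2
  rw [h1, mul_assoc, h2, mul_assoc, mul_comm Complex.I (_ * _), Complex.exp_mul_I]
  ring

/-- The solution `θ̃ + M̃ φ̃`. -/
noncomputable def weylSol (μ : ℂ) (d : ℝ) (z : ℂ) (x : ℝ) : ℂ :=
  theta μ d z x + MTilde μ d z * phi μ d z x

theorem isSolution_weylSol {μ : ℂ} (hμ : μ ≠ conj μ) (d : ℝ) (z : ℂ) :
    IsSolution (qTilde μ d) z (weylSol μ d z) :=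
  (isSolution_theta hμ d z).add_const_mul (isSolution_phi hμ d z) _

/-- The vector function belonging to the multiple `U` of `exp (i√z x)` that is transformed into
`weylSol`. -/
noncomputable def weylV (μ : ℂ) (d : ℝ) (z : ℂ) (x : ℝ) : Fin 2 → ℂ :=
  thetaV μ d z x - ((z - μ) ^ 2 * (Complex.I * sqrtUp z + d)⁻¹) •
    ((z - conj μ) ^ 2 • phiV μ d z x - S μ d x *ᵥ ![z - conj μ, 1])

/-- With `m = (i√z + d)⁻¹`, the free solution behind `θ̃ + M̃ φ̃` is `-(z - μ)² (sn + m (cs - d sn))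
= -(z - μ)² m (cs + i√z sn)`, a multiple of `e^{i√z x}`. The value of `M̃` is the one for which the
growing exponential drops out. -/
theorem weylSol_eq_transform {μ : ℂ} (hμ : μ ≠ conj μ) (d : ℝ) {z : ℂ}
    (hd : Complex.I * sqrtUp z + d ≠ 0) {x : ℝ} (hx : 0 < x) :
    weylSol μ d z x = transform μ d (fun x => -((z - μ) ^ 2 * (Complex.I * sqrtUp z + d)⁻¹) *
      Complex.exp (Complex.I * sqrtUp z * x)) (weylV μ d z) x := by
  have hPS : ∀ m, (S μ d x)⁻¹ *ᵥ (S μ d x *ᵥ m) = m := fun m => by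
    rw [Matrix.mulVec_mulVec, inv_S_mul hμ d hx, Matrix.one_mulVec]
  have hd' : star (Λ₂ μ d x) ⬝ᵥ ![z - conj μ, 1] =
      (z - conj μ) * conj (Λ₂ μ d x 0) + conj (Λ₂ μ d x 1) := by
    simp [dotProduct, Fin.sum_univ_two, mul_comm]
  have hc := cs_sub_eq hμ d z x
  rw [weylSol, theta, phi, MTilde, transform, transform, transform, weylV, Matrix.mulVec_sub,
    Matrix.mulVec_smul, Matrix.mulVec_sub, Matrix.mulVec_smul, hPS]
  simp only [dotProduct_sub, dotProduct_smul, smul_eq_mul]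
  rw [hd', ← cs_add_sn]
  set m := (Complex.I * sqrtUp z + d)⁻¹ with hm
  have hmm : (Complex.I * sqrtUp z + d) * m = 1 := mul_inv_cancel₀ hd
  linear_combination ((z - μ) ^ 2 * m) * hc + ((z - μ) ^ 2 * sn z x) * hmm

theorem hasDerivAt_weylV {μ : ℂ} (hμ : μ ≠ conj μ) (d : ℝ) {z : ℂ}
    (hd : Complex.I * sqrtUp z + d ≠ 0) (x : ℝ) :
    HasDerivAt (weylV μ d z) (-((-((z - μ) ^ 2 * (Complex.I * sqrtUp z + d)⁻¹) *
      Complex.exp (Complex.I * sqrtUp z * x)) • Λ₂ μ d x)) x := by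
  have hS : HasDerivAt (fun x => S μ d x *ᵥ ![z - conj μ, 1])
      (((z - conj μ) * conj (Λ₂ μ d x 0) + conj (Λ₂ μ d x 1)) • Λ₂ μ d x) x := by
    refine hasDerivAt_pi.2 fun i => ?_
    simp only [Matrix.mulVec, dotProduct, Fin.sum_univ_two]
    refine (((hasDerivAt_S_apply hμ d x i 0).mul_const _).add
      ((hasDerivAt_S_apply hμ d x i 1).mul_const _)).congr_deriv ?_
    simp
    ring
  have h := (hasDerivAt_thetaV hμ d z x).sub
    ((((hasDerivAt_phiV hμ d z x).const_smul ((z - conj μ) ^ 2)).sub hS).const_smul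
      ((z - μ) ^ 2 * (Complex.I * sqrtUp z + d)⁻¹))
  refine h.congr_deriv ?_
  have hc := cs_sub_eq hμ d z x
  rw [← cs_add_sn]
  set m := (Complex.I * sqrtUp z + d)⁻¹ with hm
  have hmm : (Complex.I * sqrtUp z + d) * m = 1 := mul_inv_cancel₀ hd
  ext i
  simp only [Pi.sub_apply, Pi.neg_apply, Pi.smul_apply, smul_eq_mul]
  linear_combination (-((z - μ) ^ 2 * m) * Λ₂ μ d x i) * hc -
    ((z - μ) ^ 2 * sn z x * Λ₂ μ d x i) * hmm

theorem integrableOn_exp_sqrtUp {z : ℂ} (hz : z.re < 0 ∨ z.im ≠ 0) (k : ℂ) (c : ℝ) :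
    IntegrableOn (fun x : ℝ => ‖k * Complex.exp (Complex.I * sqrtUp z * x)‖ ^ 2) (Ioi c) := by
  have h := (exp_neg_integrableOn_Ioi c (b := 2 * (sqrtUp z).im)
    (by linarith [sqrtUp_im_pos hz])).const_mul (‖k‖ ^ 2)
  refine h.congr (Eventually.of_forall fun x => ?_)
  simp only [norm_mul, Complex.norm_exp, mul_pow, ← Real.exp_nat_mul]
  congr 2
  simp
  ring

theorem isWeylSolution_weylSol {μ : ℂ} (hμ : μ ≠ conj μ) (d : ℝ) {z : ℂ}
    (hz : z.re < 0 ∨ z.im ≠ 0) (hd : Complex.I * sqrtUp z + d ≠ 0) :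
    IsWeylSolution (qTilde μ d) z (weylSol μ d z) := by
  have hs := isSolution_weylSol hμ d z
  refine ⟨hs, ?_, fun c hc => (memLp_two_Ioi_iff hs.continuousOn hc).2 ?_⟩
  -- If it vanished identically, `θ̃` would be a multiple of `φ̃`, contradicting `W(θ̃, φ̃) = 1`.
  · by_contra! hcon
    have hθ : ∀ x, 0 < x → theta μ d z x = -MTilde μ d z * phi μ d z x := fun x hx => by
      have := hcon x hx
      rw [weylSol] at this
      linear_combination this
    have e : theta μ d z =ᶠ[𝓝 1] fun x => -MTilde μ d z * phi μ d z x := by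
      filter_upwards [Ioi_mem_nhds one_pos] with x hx using hθ x hx
    have hW := wronskian_theta_phi hμ d z one_pos
    rw [wronskian, e.deriv_eq, hθ 1 one_pos,
      ((isSolution_phi hμ d z).hasDerivAt one_pos |>.const_mul _).deriv] at hW
    apply zero_ne_one (α := ℂ)
    rw [← hW]
    ring
  · have hcong : ∀ x, 0 < x → weylSol μ d z x = _ := fun x hx =>
      weylSol_eq_transform hμ d hd hx
    have h := integrableOn_transform hμ d (by fun_prop) (hasDerivAt_weylV hμ d hd)
      (hs.continuousOn.congr fun x hx => (hcong x hx).symm) hc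
      (integrableOn_exp_sqrtUp hz (-((z - μ) ^ 2 * (Complex.I * sqrtUp z + d)⁻¹)) c)
    refine h.congr_fun (fun x hx => ?_) measurableSet_Ioi
    simp only [hcong x (hc.trans hx)]

theorem isSingularWeylValue_MTilde {μ : ℂ} (hμ : μ ≠ conj μ) (d : ℝ) {z : ℂ}
    (hz : z.re < 0 ∨ z.im ≠ 0) (hd : Complex.I * sqrtUp z + d ≠ 0) :
    IsSingularWeylValue (qTilde μ d) (phi μ d) (theta μ d) z (MTilde μ d z) := by
  have hχ := isWeylSolution_weylSol hμ d hz hd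
  refine ⟨⟨_, hχ⟩, fun u hu x hx => ?_⟩
  obtain ⟨B, hB⟩ := exists_norm_qTilde_le hμ d
  have hθs := isSolution_theta hμ d z
  have hφs := isSolution_phi hμ d z
  have hW := wronskian_eq_zero hχ.1 hu.1 (continuousOn_qTilde hμ d) hB (hχ.2.2 1 one_pos)
    (hu.2.2 1 one_pos) hx
  have hsum : wronskian (theta μ d z) u x + MTilde μ d z * wronskian (phi μ d z) u x = 0 := by
    have hder : deriv (weylSol μ d z) x = deriv (theta μ d z) x +
        MTilde μ d z * deriv (phi μ d z) x :=
      ((hθs.hasDerivAt hx).add ((hφs.hasDerivAt hx).const_mul _)).deriv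
    rw [wronskian, hder, weylSol] at hW
    simp only [wronskian]
    linear_combination hW
  -- Otherwise `u` has vanishing Wronskian with both members of the fundamental system `θ̃`, `φ̃`,
  -- which forces `u = 0`.
  have hne : wronskian (phi μ d z) u x ≠ 0 := fun h0 => by
    rw [h0, mul_zero, add_zero] at hsum
    obtain ⟨t, ht, hut⟩ := hu.2.1
    rw [wronskian_const hφs hu.1 hx ht] at h0
    rw [wronskian_const hθs hu.1 hx ht] at hsum
    have h1 := wronskian_theta_phi hμ d z ht
    apply hut
    simp only [wronskian] at h0 hsum h1
    linear_combination (-u t) * h1 + phi μ d z t * hsum - theta μ d z t * h0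
  refine ⟨hne, ?_⟩
  rw [eq_div_iff hne]
  linear_combination hsum

/-- Squaring `i√z = -d` would give the real value `z = -d²`. -/
theorem sqrtUp_add_ne_zero (d : ℝ) {z : ℂ} (hz : z.im ≠ 0) :
    Complex.I * sqrtUp z + d ≠ 0 := fun h => by
  have h1 : z = ((-d ^ 2 : ℝ) : ℂ) := by
    have h2 : Complex.I * sqrtUp z = -d := by linear_combination h
    have h3 := congrArg (fun w => w ^ 2) h2
    simp only [mul_pow, Complex.I_sq, sqrtUp_sq] at h3
    push_cast
    linear_combination -h3
  rw [h1, Complex.ofReal_im] at hz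
  exact hz rfl

theorem differentiableAt_sqrtUp {z : ℂ} (hz : z.im ≠ 0) : DifferentiableAt ℂ sqrtUp z := by
  have h : -z ∈ Complex.slitPlane := Or.inr (by simpa using hz)
  exact (differentiableAt_id.neg.cpow (differentiableAt_const _) h).const_mul _

theorem differentiableOn_MTilde (μ : ℂ) (d : ℝ) :
    DifferentiableOn ℂ (MTilde μ d) {z : ℂ | z.im ≠ 0} := fun z hz => by
  have h1 := differentiableAt_sqrtUp hz
  have h2 := sqrtUp_add_ne_zero d hz
  refine DifferentiableAt.differentiableWithinAt ?_
  refine ((((differentiableAt_id.sub_const _).pow 2).mul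
    ((differentiableAt_id.sub_const _).pow 2)).mul ?_).neg
  exact ((h1.const_mul _).add_const _).inv h2

theorem MTilde_eq_zero_iff (μ : ℂ) (d : ℝ) {z : ℂ} (hd : Complex.I * sqrtUp z + d ≠ 0) :
    MTilde μ d z = 0 ↔ z = μ ∨ z = conj μ := by
  simp [MTilde, hd, sub_eq_zero]

end GBDT

theorem lemma5p2 (μ : ℂ) (hμ : μ ≠ conj μ) (d : ℝ) :
    -- `Λ₁`, `Λ₂` solve the linear system with `q ≡ 0` and the prescribed initial data
    (∀ x : ℝ, HasDerivAt (GBDT.Λ₁ μ d) (GBDT.A μ *ᵥ GBDT.Λ₂ μ d x) x ∧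
      HasDerivAt (GBDT.Λ₂ μ d) (-GBDT.Λ₁ μ d x) x) ∧
    GBDT.Λ₁ μ d 0 = ![0, (d : ℂ)] ∧ GBDT.Λ₂ μ d 0 = ![0, 1] ∧
    -- the potential is well defined, real and continuous on `(0, ∞)`, and singular at `0`
    (∀ x : ℝ, 0 < x → (GBDT.S μ d x).PosDef) ∧
    (∀ x : ℝ, 0 < x → (GBDT.qTilde μ d x).im = 0) ∧
    ContinuousOn (GBDT.qTilde μ d) (Ioi 0) ∧
    (∃ r : ℝ → ℂ, r =O[𝓝[>] 0] (fun x : ℝ => x) ∧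
      ∀ x : ℝ, 0 < x → GBDT.qTilde μ d x = 12 / (x : ℂ) ^ 2 * (1 + r x)) ∧
    -- the real entire solutions
    (∃ φ θ : ℂ → ℝ → ℂ,
      (∀ z x, 0 < x → z ≠ μ → z ≠ conj μ →
        φ z x = (GBDT.yTilde μ d z x ⬝ᵥ ![1, -(d : ℂ)]) / (z - conj μ) ^ 2) ∧
      (∀ z x, 0 < x → z ≠ μ →
        θ z x = -(z - μ) ^ 2 * (GBDT.yTilde μ d z x ⬝ᵥ ![0, 1])) ∧
      (∀ x, 0 < x → Differentiable ℂ (fun z => φ z x) ∧ Differentiable ℂ (fun z => θ z x)) ∧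
      (∀ x, 0 < x → ∀ r : ℝ, (φ r x).im = 0 ∧ (θ r x).im = 0) ∧
      (∀ z, GBDT.IsSolution (GBDT.qTilde μ d) z (φ z) ∧
        GBDT.IsSolution (GBDT.qTilde μ d) z (θ z)) ∧
      (∀ z x, 0 < x → GBDT.wronskian (θ z) (φ z) x = 1) ∧
      -- `φ` is nonsingular at `x = 0`
      (∀ z, (∃ l : ℂ, Tendsto (φ z) (𝓝[>] 0) (𝓝 l)) ∧
        ∀ c : ℝ, 0 < c → MemLp (φ z) 2 (volume.restrict (Ioo 0 c))) ∧
      -- the singular Weyl function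
      (∀ z : ℂ, z.re < 0 ∨ z.im ≠ 0 → Complex.I * GBDT.sqrtUp z + d ≠ 0 →
        GBDT.IsSingularWeylValue (GBDT.qTilde μ d) φ θ z (GBDT.MTilde μ d z))) ∧
    -- it is defined and analytic off the real axis, and its zeros are the non-real points `μ`, `μ̄`
    (∀ z : ℂ, z.im ≠ 0 → Complex.I * GBDT.sqrtUp z + d ≠ 0) ∧
    DifferentiableOn ℂ (GBDT.MTilde μ d) {z : ℂ | z.im ≠ 0} ∧
    (∀ z : ℂ, z.re < 0 ∨ z.im ≠ 0 → Complex.I * GBDT.sqrtUp z + d ≠ 0 →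
      (GBDT.MTilde μ d z = 0 ↔ z = μ ∨ z = conj μ)) := by
  refine ⟨fun x => ⟨GBDT.hasDerivAt_Λ₁ hμ d x, GBDT.hasDerivAt_Λ₂ hμ d x⟩,
    GBDT.Λ₁_at_zero hμ d, GBDT.Λ₂_at_zero μ d, fun x hx => GBDT.S_posDef hμ d hx,
    fun x _ => GBDT.qTilde_im hμ d x, GBDT.continuousOn_qTilde hμ d,
    ⟨fun x => GBDT.qTilde μ d x * (x : ℂ) ^ 2 / 12 - 1, ?_, fun x hx => ?_⟩,
    ⟨GBDT.phi μ d, GBDT.theta μ d, fun z x hx h1 h2 => GBDT.phi_eq hμ d hx h1 h2,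
      fun z x _ h1 => GBDT.theta_eq d x h1,
      fun x _ => ⟨GBDT.differentiable_phi hμ d x, GBDT.differentiable_theta μ d x⟩,
      fun x hx r => ⟨GBDT.phi_im hμ r d hx, GBDT.theta_im hμ r d hx⟩,
      fun z => ⟨GBDT.isSolution_phi hμ d z, GBDT.isSolution_theta hμ d z⟩,
      fun z x hx => GBDT.wronskian_theta_phi hμ d z hx,
      fun z => ⟨⟨0, GBDT.tendsto_phi hμ d z⟩, fun c _ => GBDT.memLp_of_tendsto
        (GBDT.isSolution_phi hμ d z).continuousOn (GBDT.tendsto_phi hμ d z) c⟩,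
      fun z hz hd => GBDT.isSingularWeylValue_MTilde hμ d hz hd⟩,
    fun z hz => GBDT.sqrtUp_add_ne_zero d hz, GBDT.differentiableOn_MTilde μ d,
    fun z _ hd => GBDT.MTilde_eq_zero_iff μ d hd⟩
  · have h := (GBDT.limO_qTilde hμ d).mul (GBDT.LimO.const (1 / 12))
    refine Asymptotics.IsBigO.congr_left h fun x => ?_
    ring
  · have hxc : (x : ℂ) ≠ 0 := by exact_mod_cast hx.ne'
    field_simp
    ring
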